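/- Let $N\ge 1$ be an integer and let $a\in\mathbb{R}$ with $a>\max\{0,2-N\}$. For $\nu\in\mathbb{R}$, $w\in\mathbb{C}$ let $$\tilde I_\nu(w)=\sum_{k=0}^{\infty}\frac{(w/2)^{2k}}{k!\,\Gamma(\nu+k+1)},$$ let $\check C^{\nu}_m(u)$ be defined by $\dfrac{1-x^2}{(1-2ux+x^2)^{\nu+1}}=\sum_{m=0}^\infty \check C^\nu_m(u)\,x^m$, and put $$\mathscr{I}(b,\nu,w,u)=\Gamma(b\nu+1)\sum_{m=0}^\infty\Big(\frac w2\Big)^{bm}\tilde I_{b(m+\nu)}(w)\,\check C^\nu_m(u)$$ with principal powers. The kernel of the $a$-generalized Fourier transform on $\mathbb{R}^N$ is $$B_a(r\omega,s\mu)=\mathscr{I}\Big(\frac2a,\frac{N-2}2,\frac{2(rs)^{a/2}}{a i},\langle\omega,\mu\rangle\Big)\qquad(r,s\ge 0,\ |\omega|=|\mu|=1).$$ Put $c_a=\Big(\int_{\mathbb{R}^N}e^{-|x|^a/a}\,|x|^{a-2}\,dx\Big)^{-1}$ and, for $x,y\in\mathbb{R}^N$ and $t>0$, let $$h_a(x,y;t)=c_a\int_{\mathbb{R}^N}\overline{B_a(x,\xi)}\,B_a(y,\xi)\,e^{-\frac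 ta|\xi|^a}\,|\xi|^{a-2}\,d\xi$$ be the $a$-deformed heat kernel. (1) For all $x\in\mathbb{R}^N$ and $t>0$, the function $y\mapsto h_a(x,y;t)\,|y|^{a-2}$ is integrable on $\mathbb{R}^N$ and $$c_a\int_{\mathbb{R}^N}h_a(x,y;t)\,|y|^{a-2}\,dy=1.$$ (2) For every integer $m\ge 0$ there is a nonzero homogeneous polynomial $f_m(T,X)$ of degree $m$ in two variables with real coefficients, which does not depend on $x$ and $t$, such that for all $x\in\mathbb{R}^N$ and $t>0$ the function $y\mapsto h_a(x,y;t)\,|y|^{ma}\,|y|^{a-2}$ is integrable on $\mathbb{R}^N$ and $$c_a\int_{\mathbb{R}^N}h_a(x,y;t)\,|y|^{ma}\,|y|^{a-2}\,dy=f_m(t,|x|^a).$$ -/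

import Mathlib

open scoped Nat ComplexConjugate

noncomputable section

namespace DeformedHeat

/-- The normalized modified Bessel function
`Ĩ_ν(w) = ∑ₖ (w/2)^(2k) / (k! Γ(ν+k+1))`, for a real index `ν` and a complex argument `w`. -/
def normalizedBesselI (ν : ℝ) (w : ℂ) : ℂ :=
  ∑' k : ℕ, (w / 2) ^ (2 * k) / ((k ! : ℂ) * (Real.Gamma (ν + k + 1) : ℂ))

/-- The normalized Gegenbauer polynomial: the `m`-th coefficient of the expansion at `x = 0` of
`(1 - x²) / (1 - 2ux + x²)^(ν+1)`. -/
def normalizedGegenbauer (ν : ℝ) (m : ℕ) (u : ℝ) : ℝ :=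
  iteratedDeriv m (fun x : ℝ => (1 - x ^ 2) / (1 - 2 * u * x + x ^ 2) ^ (ν + 1)) 0 / (m ! : ℝ)

/-- The function
`𝓘(b, ν, w, u) = Γ(bν+1) ∑ₘ (w/2)^(bm) Ĩ_{b(m+ν)}(w) Č_m^ν(u)`; powers of the complex number `w/2`
are principal (and `0 ^ 0 = 1`). -/
def scriptI (b ν : ℝ) (w : ℂ) (u : ℝ) : ℂ :=
  (Real.Gamma (b * ν + 1) : ℂ) *
    ∑' m : ℕ, (w / 2) ^ ((b * m : ℝ) : ℂ) * normalizedBesselI (b * (m + ν)) w *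
      (normalizedGegenbauer ν m u : ℂ)

/-- The integral kernel of the `a`-generalized Fourier transform on `ℝᴺ`,
`B_a(rω, sμ) = 𝓘(2/a, (N-2)/2, 2(rs)^(a/2)/(ai), ⟨ω, μ⟩)` for unit vectors `ω`, `μ` and `r, s ≥ 0`.
If `r s = 0` then only the term `m = 0` of the series survives and the value does not depend on
the last argument. -/
def fourierKernel {N : ℕ} (a : ℝ) (x y : EuclideanSpace ℝ (Fin N)) : ℂ :=
  scriptI (2 / a) (((N : ℝ) - 2) / 2)
    (2 * (((‖x‖ * ‖y‖) ^ (a / 2) : ℝ) : ℂ) / ((a : ℂ) * Complex.I))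
    (inner ℝ x y / (‖x‖ * ‖y‖))

/-- The normalizing constant `c_a = (∫ e^{-|x|^a/a} |x|^(a-2) dx)⁻¹`. -/
def normConst (N : ℕ) (a : ℝ) : ℝ :=
  (∫ x : EuclideanSpace ℝ (Fin N), Real.exp (-(1 / a) * ‖x‖ ^ a) * ‖x‖ ^ (a - 2))⁻¹

/-- The `a`-deformed heat kernel
`h_a(x, y; t) = c_a ∫ conj(B_a(x, ξ)) B_a(y, ξ) e^{-(t/a)|ξ|^a} |ξ|^(a-2) dξ`. -/
def heatKernel {N : ℕ} (a : ℝ) (x y : EuclideanSpace ℝ (Fin N)) (t : ℝ) : ℂ :=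
  (normConst N a : ℂ) *
    ∫ ξ : EuclideanSpace ℝ (Fin N),
      conj (fourierKernel a x ξ) * fourierKernel a y ξ *
        ((Real.exp (-(t / a) * ‖ξ‖ ^ a) * ‖ξ‖ ^ (a - 2) : ℝ) : ℂ)

end DeformedHeat

end

/-! ### Bessel series, their growth, and the Laguerre sums generated by them. -/

namespace DeformedHeat

open MeasureTheory Filter Topology

/-! Everything follows from an explicit series for the heat kernel. Put l_m = (2m + N - 2)/a
(`besselIndex`); for a > 0 the condition a > 2 - N says exactly that l_0 > -1, which makes all
radial integrals converge at the origin. By `fourierKernel_eq_tsum` the Fourier kernel is a series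
over m of a unimodular phase, a zonal solid harmonic of degree m, and a real Bessel function of
order l_m in (|x||y|)^a. When conj(B_a(x, ξ)) B_a(y, ξ) is integrated against a radial weight,
orthogonality of zonal harmonics of different degrees leaves the diagonal terms, where the phases
cancel. The radial integrals left over are Weber's second exponential integral
(`integral_besselSeries_mul_besselSeries`). Hence `heatKernel_eq`: up to the factor Γ(l_0+1)
t^(-(l_0+1)) exp(-(|x|^a + |y|^a)/(at)), the heat kernel is the same kind of series with a replaced
by at in the scaling and without phases or alternating signs.

To find a moment, integrate this series against a radial power of |y|. Orthogonality to the constant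
harmonic kills every term but m = 0, and `integral_rpow_mul_besselSeries` evaluates that term as a
Laguerre polynomial in |x|^a/(at) times exp(|x|^a/(at)). The exponential cancels the Gaussian
prefactor in x. Multiplication by (at)^M turns the Laguerre polynomial of degree M into a form of
degree M in t and |x|^a; for M = 0 it is 1, which is the conservation of mass.

Two ingredients carry the rest. Orthogonality and the reproducing property
(`sphereIntegral_zonalPoly_mul`) come from Gaussian integration by parts on ℝᴺ, transferred to the
sphere by homogeneity, so N = 1 and N = 2 need no separate treatment. The interchanges of sum and
integral rest on `exists_abs_zonalBessel_le`: geometric decay in m, with an exponential growth rate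
in |y|^a that can be prescribed arbitrarily small. -/

/-- The entire function `∑ₖ zᵏ / (k! Γ(l+k+1))` of a real argument. -/
noncomputable def besselSeries (l z : ℝ) : ℝ :=
  ∑' k : ℕ, z ^ k / ((k ! : ℝ) * Real.Gamma (l + k + 1))

theorem Gamma_add_nat_pos {l : ℝ} (hl : -1 < l) (k : ℕ) : 0 < Real.Gamma (l + k + 1) :=
  Real.Gamma_pos_of_pos (by have := Nat.cast_nonneg (α := ℝ) k; linarith)

theorem hasSum_exp (z : ℝ) : HasSum (fun k : ℕ => z ^ k / k !) (Real.exp z) := by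
  rw [Real.exp_eq_exp_ℝ]
  exact NormedSpace.expSeries_div_hasSum_exp z

theorem Gamma_mul_pow_mul_factorial_le {l c : ℝ} (hl : -1 < l) (hc : 0 ≤ c) (hc1 : c ≤ 1)
    (hcl : c ≤ 1 + l) (k : ℕ) :
    Real.Gamma (l + 1) * (c ^ k * k !) ≤ Real.Gamma (l + k + 1) := by
  induction k with
  | zero => simp
  | succ k ih =>
    have hk := Nat.cast_nonneg (α := ℝ) k
    have h1 : Real.Gamma (l + (k + 1 : ℕ) + 1) = (l + k + 1) * Real.Gamma (l + k + 1) := by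
      rw [← Real.Gamma_add_one (by linarith)]; push_cast; ring_nf
    rw [h1, Nat.factorial_succ]
    have h2 : c * (k + 1) ≤ l + k + 1 := by nlinarith
    calc Real.Gamma (l + 1) * (c ^ (k + 1) * ((k + 1) * k ! : ℕ))
        = (c * (k + 1)) * (Real.Gamma (l + 1) * (c ^ k * k !)) := by push_cast; ring
      _ ≤ (l + k + 1) * Real.Gamma (l + k + 1) :=
        mul_le_mul h2 ih (mul_nonneg (Real.Gamma_pos_of_pos (by linarith)).le (by positivity))
          (by linarith)

/-- Since Γ(l+k+1) dominates c^k k! Γ(l+1), each term has two factorials in the denominator. One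
absorbs (1/(ec))^k at the cost of a constant, leaving an exponential series of arbitrarily small
rate `e`. The constant `c` can be shared by all larger `l`, and 1/Γ(l+1) is kept to control the sum
over degrees later. -/
theorem abs_besselSeries_term_le {l c e : ℝ} (hl : -1 < l) (hc : 0 < c) (hc1 : c ≤ 1)
    (hcl : c ≤ 1 + l) (he : 0 < e) (z : ℝ) (k : ℕ) :
    |z ^ k / ((k ! : ℝ) * Real.Gamma (l + k + 1))| ≤
      Real.exp (1 / (e * c)) / Real.Gamma (l + 1) * ((e * |z|) ^ k / k !) := by
  have hG := Gamma_add_nat_pos hl k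
  have hG1 : 0 < Real.Gamma (l + 1) := Real.Gamma_pos_of_pos (by linarith)
  have hk : (0 : ℝ) < k ! := by positivity
  rw [abs_div, abs_mul, abs_of_pos hG, abs_pow, abs_of_pos hk]
  have h1 := Real.pow_div_factorial_le_exp (1 / (e * c)) (by positivity) k
  calc |z| ^ k / (k ! * Real.Gamma (l + k + 1))
      ≤ |z| ^ k / (k ! * (Real.Gamma (l + 1) * (c ^ k * k !))) := by
        gcongr
        exact Gamma_mul_pow_mul_factorial_le hl hc.le hc1 hcl k
    _ = (1 / (e * c)) ^ k / k ! / Real.Gamma (l + 1) * ((e * |z|) ^ k / k !) := by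
        have h2 : |z| ^ k = c ^ k * ((1 / (e * c)) ^ k * (e * |z|) ^ k) := by
          rw [← mul_pow, ← mul_pow]
          congr 1
          field_simp
        rw [h2]
        field_simp
    _ ≤ _ := by gcongr

theorem min_one_add_pos {l : ℝ} (hl : -1 < l) : 0 < min 1 (1 + l) :=
  lt_min one_pos (by linarith)

theorem summable_abs_besselSeries {l : ℝ} (hl : -1 < l) (z : ℝ) :
    Summable fun k : ℕ => |z ^ k / ((k ! : ℝ) * Real.Gamma (l + k + 1))| :=
  Summable.of_nonneg_of_le (fun _ => abs_nonneg _)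
    (abs_besselSeries_term_le hl (min_one_add_pos hl) (min_le_left _ _) (min_le_right _ _)
      one_pos z)
    ((Real.summable_pow_div_factorial _).mul_left _)

theorem hasSum_besselSeries {l : ℝ} (hl : -1 < l) (z : ℝ) :
    HasSum (fun k : ℕ => z ^ k / ((k ! : ℝ) * Real.Gamma (l + k + 1))) (besselSeries l z) :=
  (summable_abs_besselSeries hl z).of_abs.hasSum

theorem abs_besselSeries_le {l c e : ℝ} (hl : -1 < l) (hc : 0 < c) (hc1 : c ≤ 1)
    (hcl : c ≤ 1 + l) (he : 0 < e) (z : ℝ) :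
    |besselSeries l z| ≤
      Real.exp (1 / (e * c)) / Real.Gamma (l + 1) * Real.exp (e * |z|) := by
  rw [besselSeries, ← Real.norm_eq_abs]
  exact tsum_of_norm_bounded ((hasSum_exp (e * |z|)).mul_left _)
    (abs_besselSeries_term_le hl hc hc1 hcl he z)

theorem abs_besselSeries_le_abs {l : ℝ} (hl : -1 < l) (z : ℝ) :
    |besselSeries l z| ≤ besselSeries l |z| := by
  rw [besselSeries, ← Real.norm_eq_abs]
  refine tsum_of_norm_bounded (hasSum_besselSeries hl |z|) fun k => ?_
  rw [Real.norm_eq_abs, abs_div, abs_pow, abs_of_pos (mul_pos _ (Gamma_add_nat_pos hl k))]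
  positivity

theorem continuous_besselSeries {l : ℝ} (hl : -1 < l) : Continuous (besselSeries l) := by
  rw [continuous_iff_continuousAt]
  intro z
  have h : ContinuousOn (besselSeries l) (Metric.ball 0 (|z| + 1)) := by
    refine continuousOn_tsum (u := fun k : ℕ => |(|z| + 1) ^ k / ((k ! : ℝ) *
      Real.Gamma (l + k + 1))|) (fun k => by fun_prop) (summable_abs_besselSeries hl _) ?_
    intro k x hx
    rw [Real.norm_eq_abs, abs_div, abs_div, abs_pow, abs_pow]
    have : |x| ≤ |(|z| + 1)| := by
      rw [abs_of_nonneg (by positivity : 0 ≤ |z| + 1)]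
      simpa using (Metric.mem_ball.1 hx).le
    gcongr
  exact h.continuousAt (Metric.isOpen_ball.mem_nhds (by simp))

/-- A form of the Chu–Vandermonde identity. -/
theorem Gamma_div_eq_sum_antidiagonal {l : ℝ} (hl : -1 < l) (M j : ℕ) :
    Real.Gamma (l + M + j + 1) / (Real.Gamma (l + j + 1) * j !) =
      ∑ p ∈ Finset.HasAntidiagonal.antidiagonal j,
        (M.choose p.1 : ℝ) * Real.Gamma (l + M + 1) / Real.Gamma (l + p.1 + 1) * (1 / p.2 !) := by
  induction M generalizing l j with
  | zero =>
    rw [Finset.sum_eq_single (0, j)]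
    · have h1 := Gamma_add_nat_pos hl j
      have h2 : 0 < Real.Gamma (l + 1) := Real.Gamma_pos_of_pos (by linarith)
      simp
      field_simp
    · rintro ⟨_ | p, q⟩ hmem hne
      · simp_all
      · simp
    · simp
  | succ M ih =>
    have hM := Nat.cast_nonneg (α := ℝ) M
    have hG1 : Real.Gamma (l + (M + 1 : ℕ) + 1) = (l + M + 1) * Real.Gamma (l + M + 1) := by
      rw [← Real.Gamma_add_one (by linarith)]; push_cast; ring_nf
    cases j with
    | zero =>
      have h1 := Gamma_add_nat_pos hl (M + 1)
      have h2 : 0 < Real.Gamma (l + 1) := Real.Gamma_pos_of_pos (by linarith)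
      simp
    | succ j =>
      have hj := Nat.cast_nonneg (α := ℝ) j
      -- Pascal's rule splits the sum into the instances (l, j + 1) and (l + 1, j) for M; the shift
      -- of l is why the induction generalizes it.
      have h1 : ∑ p ∈ Finset.HasAntidiagonal.antidiagonal (j + 1), ((M + 1).choose p.1 : ℝ) *
            Real.Gamma (l + (M + 1 : ℕ) + 1) / Real.Gamma (l + p.1 + 1) * (1 / p.2 !) =
          (l + M + 1) * ∑ p ∈ Finset.HasAntidiagonal.antidiagonal (j + 1), (M.choose p.1 : ℝ) *
            Real.Gamma (l + M + 1) / Real.Gamma (l + p.1 + 1) * (1 / p.2 !) +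
          ∑ p ∈ Finset.HasAntidiagonal.antidiagonal j, (M.choose p.1 : ℝ) *
            Real.Gamma (l + 1 + M + 1) / Real.Gamma (l + 1 + p.1 + 1) * (1 / p.2 !) := by
        rw [Finset.Nat.sum_antidiagonal_succ, Finset.Nat.sum_antidiagonal_succ, mul_add,
          Finset.mul_sum, add_assoc ((l + M + 1) * _), ← Finset.sum_add_distrib]
        congr 1
        · rw [hG1]; simp; ring
        · refine Finset.sum_congr rfl fun p _ => ?_
          have e1 : l + 1 + (M : ℝ) + 1 = l + (M + 1 : ℕ) + 1 := by push_cast; ring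
          have e2 : l + 1 + (p.1 : ℝ) + 1 = l + (p.1 + 1 : ℕ) + 1 := by push_cast; ring
          rw [e1, e2, hG1, Nat.choose_succ_succ]
          push_cast
          ring
      rw [h1, ← ih hl, ← ih (by linarith : -1 < l + 1)]
      have e3 : l + 1 + (M : ℝ) + j + 1 = l + M + (j + 1 : ℕ) + 1 := by push_cast; ring
      have e4 : l + 1 + (j : ℝ) + 1 = l + (j + 1 : ℕ) + 1 := by push_cast; ring
      have e5 : l + (M + 1 : ℕ) + (j + 1 : ℕ) + 1 = (l + M + (j + 1 : ℕ) + 1) + 1 := by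
        push_cast; ring
      rw [e3, e4, e5, Real.Gamma_add_one (by push_cast; linarith)]
      have hp := Gamma_add_nat_pos hl (j + 1)
      have hf : ((j + 1)! : ℝ) = (j + 1) * j ! := by rw [Nat.factorial_succ]; push_cast; ring
      rw [hf]
      field_simp
      push_cast
      ring

/-- A multiple of the Laguerre polynomial of degree `M` and order `l` at `-z`. -/
noncomputable def laguerreSum (l : ℝ) (M : ℕ) (z : ℝ) : ℝ :=
  ∑ i ∈ Finset.range (M + 1),
    (M.choose i : ℝ) * Real.Gamma (l + M + 1) / Real.Gamma (l + i + 1) * z ^ i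

theorem hasSum_laguerreSum (l : ℝ) (M : ℕ) (z : ℝ) :
    HasSum (fun i : ℕ => (M.choose i : ℝ) * Real.Gamma (l + M + 1) / Real.Gamma (l + i + 1) * z ^ i)
      (laguerreSum l M z) := by
  refine hasSum_sum_of_ne_finset_zero fun i hi => ?_
  rw [Nat.choose_eq_zero_of_lt (by simpa [Nat.lt_succ_iff] using hi)]
  simp

theorem hasSum_antidiagonal_mul {f g : ℕ → ℝ} {A B : ℝ} (hf : HasSum f A) (hg : HasSum g B)
    (hf' : Summable fun i => ‖f i‖) (hg' : Summable fun i => ‖g i‖) :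
    HasSum (fun n => ∑ p ∈ Finset.HasAntidiagonal.antidiagonal n, f p.1 * g p.2) (A * B) := by
  rw [← hf.tsum_eq, ← hg.tsum_eq, tsum_mul_tsum_eq_tsum_sum_antidiagonal_of_summable_norm hf' hg']
  exact (summable_norm_sum_mul_antidiagonal_of_summable_norm hf' hg').of_norm.hasSum

theorem summable_norm_exp (z : ℝ) : Summable (fun k : ℕ => ‖z ^ k / (k ! : ℝ)‖) :=
  NormedSpace.norm_expSeries_div_summable z

/-- This is Kummer's transformation for a confluent hypergeometric series that becomes a polynomial
times an exponential. The Cauchy product of the polynomial and the exponential series has the right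
coefficients by Chu–Vandermonde. -/
theorem hasSum_Gamma_ratio {l : ℝ} (hl : -1 < l) (M : ℕ) (z : ℝ) :
    HasSum (fun j : ℕ => z ^ j * (Real.Gamma (l + M + j + 1) / (Real.Gamma (l + j + 1) * j !)))
      (laguerreSum l M z * Real.exp z) := by
  have hsum : Summable fun i : ℕ => ‖(M.choose i : ℝ) * Real.Gamma (l + M + 1) /
      Real.Gamma (l + i + 1) * z ^ i‖ := by
    refine summable_of_ne_finset_zero (s := Finset.range (M + 1)) fun i hi => ?_
    rw [Nat.choose_eq_zero_of_lt (by simpa [Nat.lt_succ_iff] using hi)]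
    simp
  convert hasSum_antidiagonal_mul (hasSum_laguerreSum l M z) (hasSum_exp z) hsum
    (summable_norm_exp z) using 2 with j
  rw [Gamma_div_eq_sum_antidiagonal hl, Finset.mul_sum]
  refine Finset.sum_congr rfl fun p hp => ?_
  rw [← Finset.HasAntidiagonal.mem_antidiagonal.1 hp, pow_add]
  ring

/-- The classical Laguerre generating function: the Cauchy product of the Bessel series at xy with
the exponential series at x. -/
theorem hasSum_laguerreSum_mul {l : ℝ} (hl : -1 < l) (x y : ℝ) :
    HasSum (fun k : ℕ => x ^ k / ((k ! : ℝ) * Real.Gamma (l + k + 1)) * laguerreSum l k y)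
      (besselSeries l (x * y) * Real.exp x) := by
  convert hasSum_antidiagonal_mul (hasSum_besselSeries hl (x * y)) (hasSum_exp x)
    (summable_abs_besselSeries hl (x * y)) (summable_norm_exp x) using 2 with k
  rw [laguerreSum, Finset.Nat.sum_antidiagonal_eq_sum_range_succ
    (fun i d => (x * y) ^ i / ((i ! : ℝ) * Real.Gamma (l + i + 1)) * (x ^ d / d !)),
    Finset.mul_sum]
  refine Finset.sum_congr rfl fun i hi => ?_
  have hik : i ≤ k := Nat.lt_succ_iff.1 (Finset.mem_range.1 hi)
  rw [Nat.cast_choose ℝ hik]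
  have h1 := Gamma_add_nat_pos hl k
  have h2 := Gamma_add_nat_pos hl i
  have h3 : x ^ k = x ^ i * x ^ (k - i) := by rw [← pow_add]; congr 1; omega
  rw [h3, mul_pow]
  field_simp

end DeformedHeat

/-! ### Radial integrals: moments of Bessel functions and Weber's integral. -/

namespace DeformedHeat

open MeasureTheory Filter Topology

variable {a l t : ℝ}

theorem integrableOn_rpow_mul_exp (ha : 0 < a) (hl : -1 < l) (ht : 0 < t) (k : ℕ) :
    IntegrableOn (fun s : ℝ => s ^ (a * (l + k + 1) - 1) * Real.exp (-t * s ^ a)) (Set.Ioi 0) := by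
  refine integrableOn_rpow_mul_exp_neg_mul_rpow ?_ ha ht
  have := mul_pos ha (by linarith [Nat.cast_nonneg (α := ℝ) k] : 0 < l + k + 1)
  linarith

theorem integral_rpow_mul_exp (ha : 0 < a) (hl : -1 < l) (ht : 0 < t) (k : ℕ) :
    ∫ s in Set.Ioi (0 : ℝ), s ^ (a * (l + k + 1) - 1) * Real.exp (-t * s ^ a) =
      1 / a * t ^ (-(l + 1)) * (1 / t) ^ k * Real.Gamma (l + k + 1) := by
  have := mul_pos ha (by linarith [Nat.cast_nonneg (α := ℝ) k] : 0 < l + k + 1)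
  rw [integral_rpow_mul_exp_neg_mul_rpow ha (by linarith) ht]
  have e1 : (a * (l + k + 1) - 1 + 1) / a = l + k + 1 := by field_simp; ring
  have e2 : -(a * (l + k + 1) - 1 + 1) / a = -(l + 1) + -(k : ℝ) := by field_simp; ring
  rw [e1, e2, Real.rpow_add ht, Real.rpow_neg ht.le (k : ℝ), Real.rpow_natCast, one_div_pow]
  ring

theorem rpow_mul_pow_rpow {s : ℝ} (hs : 0 < s) (p A : ℝ) (k : ℕ) :
    s ^ (a * p - 1) * (A * s ^ a) ^ k = A ^ k * s ^ (a * (p + k) - 1) := by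
  rw [mul_pow, ← Real.rpow_natCast (s ^ a) k, ← Real.rpow_mul hs.le,
    show a * (p + k) - 1 = (a * p - 1) + a * k by ring, Real.rpow_add hs]
  ring

theorem integrableOn_rpow_mul_besselSeries (ha : 0 < a) (hl : -1 < l) (ht : 0 < t) (A : ℝ)
    (k : ℕ) :
    IntegrableOn (fun s : ℝ => s ^ (a * (l + k + 1) - 1) * besselSeries l (A * s ^ a) *
      Real.exp (-t * s ^ a)) (Set.Ioi 0) := by
  -- The growth rate of the Bessel factor is made small enough to use only half of the decay exp(-t
  -- s^a).
  obtain ⟨e, he, heA⟩ : ∃ e > 0, e * |A| ≤ t / 2 := by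
    refine ⟨t / (2 * (|A| + 1)), by positivity, ?_⟩
    have := abs_nonneg A
    rw [div_mul_eq_mul_div, div_le_div_iff₀ (by positivity) (by positivity)]
    nlinarith
  have hb := abs_besselSeries_le hl (min_one_add_pos hl) (min_le_left _ _) (min_le_right _ _) he
  set C := Real.exp (1 / (e * min 1 (1 + l))) / Real.Gamma (l + 1)
  refine ((integrableOn_rpow_mul_exp ha hl (half_pos ht) k).const_mul C).mono' ?_ ?_
  · have := continuous_besselSeries hl
    have h1 : Measurable fun s : ℝ => besselSeries l (A * s ^ a) :=
      this.measurable.comp (by fun_prop)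
    exact (by fun_prop : Measurable fun s : ℝ => s ^ (a * (l + k + 1) - 1) *
      besselSeries l (A * s ^ a) * Real.exp (-t * s ^ a)).aestronglyMeasurable
  · filter_upwards [ae_restrict_mem measurableSet_Ioi] with s hs
    have hs : 0 < s := hs
    have hsa : 0 ≤ s ^ a := by positivity
    have hp : 0 ≤ s ^ (a * (l + k + 1) - 1) := by positivity
    have hC : 0 ≤ C := div_nonneg (Real.exp_pos _).le (Real.Gamma_pos_of_pos (by linarith)).le
    rw [norm_mul, norm_mul, Real.norm_of_nonneg hp, Real.norm_of_nonneg (Real.exp_pos _).le,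
      Real.norm_eq_abs]
    have h1 : |besselSeries l (A * s ^ a)| ≤ C * Real.exp (t / 2 * s ^ a) := by
      refine (hb _).trans ?_
      rw [abs_mul, abs_of_nonneg hsa, ← mul_assoc]
      gcongr
    calc _ ≤ s ^ (a * (l + k + 1) - 1) * (C * Real.exp (t / 2 * s ^ a)) *
        Real.exp (-t * s ^ a) := by gcongr
      _ = C * (s ^ (a * (l + k + 1) - 1) *
        (Real.exp (t / 2 * s ^ a) * Real.exp (-t * s ^ a))) := by ring
      _ = _ := by rw [← Real.exp_add]; ring_nf

/-- The moments of a Bessel function against a generalized Gaussian. -/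
theorem integral_rpow_mul_besselSeries (ha : 0 < a) (hl : -1 < l) (ht : 0 < t) (A : ℝ) (M : ℕ) :
    ∫ s in Set.Ioi (0 : ℝ), s ^ (a * (l + M + 1) - 1) * besselSeries l (A * s ^ a) *
      Real.exp (-t * s ^ a) =
      1 / a * t ^ (-(l + 1)) * (1 / t) ^ M * (laguerreSum l M (A / t) * Real.exp (A / t)) := by
  set F : ℕ → ℝ → ℝ := fun k s => A ^ k / (k ! * Real.Gamma (l + k + 1)) *
    (s ^ (a * (l + (M + k : ℕ) + 1) - 1) * Real.exp (-t * s ^ a))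
  have hint : ∀ B : ℝ, ∀ k : ℕ, ∫ s in Set.Ioi (0 : ℝ),
      B ^ k / (k ! * Real.Gamma (l + k + 1)) *
        (s ^ (a * (l + (M + k : ℕ) + 1) - 1) * Real.exp (-t * s ^ a)) =
      1 / a * t ^ (-(l + 1)) * (1 / t) ^ M *
        ((B / t) ^ k * (Real.Gamma (l + M + k + 1) / (Real.Gamma (l + k + 1) * k !))) := by
    intro B k
    rw [integral_const_mul, integral_rpow_mul_exp ha hl ht]
    push_cast
    rw [← add_assoc]
    ring
  have hF : ∀ k, Integrable (F k) (volume.restrict (Set.Ioi 0)) := fun k =>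
    (integrableOn_rpow_mul_exp ha hl ht (M + k)).const_mul _
  -- Taking norms merely replaces A by |A|, so the same convergent series justifies termwise
  -- integration.
  have hnorm : ∀ k, ∫ s in Set.Ioi (0 : ℝ), ‖F k s‖ = 1 / a * t ^ (-(l + 1)) * (1 / t) ^ M *
        ((|A| / t) ^ k * (Real.Gamma (l + M + k + 1) / (Real.Gamma (l + k + 1) * k !))) := by
    intro k
    rw [← hint]
    refine setIntegral_congr_fun measurableSet_Ioi fun s hs => ?_
    have hs : 0 < s := hs
    simp only [F]
    rw [norm_mul, norm_div, norm_pow, Real.norm_eq_abs, Real.norm_of_nonneg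
      (mul_nonneg (by positivity) (Gamma_add_nat_pos hl k).le), Real.norm_of_nonneg (by positivity)]
  have hsum : Summable fun k => ∫ s in Set.Ioi (0 : ℝ), ‖F k s‖ := by
    simp_rw [hnorm]
    exact (hasSum_Gamma_ratio hl M (|A| / t)).summable.mul_left _
  have h1 := hasSum_integral_of_summable_integral_norm hF hsum
  simp only [F, hint] at h1
  rw [((hasSum_Gamma_ratio hl M (A / t)).mul_left _).unique h1]
  refine setIntegral_congr_fun measurableSet_Ioi fun s hs => ?_
  have h2 := ((hasSum_besselSeries hl (A * s ^ a)).mul_left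
    (s ^ (a * (l + M + 1) - 1))).mul_right (Real.exp (-t * s ^ a))
  rw [← h2.tsum_eq]
  refine tsum_congr fun k => ?_
  rw [← mul_div_assoc, rpow_mul_pow_rpow hs]
  push_cast
  ring_nf

/-- **Weber's second exponential integral.** -/
theorem integral_besselSeries_mul_besselSeries (ha : 0 < a) (hl : -1 < l) (ht : 0 < t)
    (A B : ℝ) :
    ∫ s in Set.Ioi (0 : ℝ), s ^ (a * (l + 1) - 1) * besselSeries l (A * s ^ a) *
      besselSeries l (B * s ^ a) * Real.exp (-t * s ^ a) =
      1 / a * t ^ (-(l + 1)) * Real.exp ((A + B) / t) * besselSeries l (A * B / t ^ 2) := by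
  -- Only the Bessel factor containing A is expanded. Each term is then a moment of the other
  -- factor, hence a Laguerre sum, and the generating function sums these.
  set F : ℕ → ℝ → ℝ := fun k s => A ^ k / (k ! * Real.Gamma (l + k + 1)) *
    (s ^ (a * (l + k + 1) - 1) * besselSeries l (B * s ^ a) * Real.exp (-t * s ^ a))
  have hint : ∀ A B : ℝ, ∀ k : ℕ, ∫ s in Set.Ioi (0 : ℝ),
      A ^ k / (k ! * Real.Gamma (l + k + 1)) *
        (s ^ (a * (l + k + 1) - 1) * besselSeries l (B * s ^ a) * Real.exp (-t * s ^ a)) =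
      1 / a * t ^ (-(l + 1)) * Real.exp (B / t) *
        ((A / t) ^ k / (k ! * Real.Gamma (l + k + 1)) * laguerreSum l k (B / t)) := by
    intro A B k
    rw [integral_const_mul, integral_rpow_mul_besselSeries ha hl ht]
    ring
  have hF : ∀ k, Integrable (F k) (volume.restrict (Set.Ioi 0)) := fun k =>
    (integrableOn_rpow_mul_besselSeries ha hl ht B k).const_mul _
  have hnorm : ∀ k, ∫ s in Set.Ioi (0 : ℝ), ‖F k s‖ ≤ 1 / a * t ^ (-(l + 1)) *
      Real.exp (|B| / t) *
        ((|A| / t) ^ k / (k ! * Real.Gamma (l + k + 1)) * laguerreSum l k (|B| / t)) := by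
    intro k
    rw [← hint]
    refine setIntegral_mono_on (hF k).norm
      ((integrableOn_rpow_mul_besselSeries ha hl ht |B| k).const_mul _) measurableSet_Ioi
      fun s hs => ?_
    have hs : 0 < s := hs
    have hG := Gamma_add_nat_pos hl k
    have h3 := abs_besselSeries_le_abs hl (B * s ^ a)
    rw [abs_mul, abs_of_nonneg (by positivity : 0 ≤ s ^ a)] at h3
    simp only [F]
    rw [norm_mul, norm_div, norm_pow, Real.norm_eq_abs A, Real.norm_of_nonneg
      (by positivity : 0 ≤ (k ! : ℝ) * Real.Gamma (l + k + 1)), norm_mul, norm_mul,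
      Real.norm_of_nonneg (by positivity : 0 ≤ s ^ (a * (l + k + 1) - 1)),
      Real.norm_of_nonneg (Real.exp_pos _).le, Real.norm_eq_abs]
    gcongr
  have hsum : Summable fun k => ∫ s in Set.Ioi (0 : ℝ), ‖F k s‖ :=
    Summable.of_nonneg_of_le (fun k => integral_nonneg fun s => norm_nonneg _) hnorm
      ((hasSum_laguerreSum_mul hl (|A| / t) (|B| / t)).summable.mul_left _)
  have h1 := hasSum_integral_of_summable_integral_norm hF hsum
  simp only [F, hint] at h1
  have h4 := ((hasSum_laguerreSum_mul hl (A / t) (B / t)).mul_left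
    (1 / a * t ^ (-(l + 1)) * Real.exp (B / t))).unique h1
  rw [show A / t * (B / t) = A * B / t ^ 2 by field_simp] at h4
  rw [add_div, Real.exp_add]
  trans 1 / a * t ^ (-(l + 1)) * Real.exp (B / t) *
    (besselSeries l (A * B / t ^ 2) * Real.exp (A / t))
  swap
  · ring
  rw [h4]
  refine setIntegral_congr_fun measurableSet_Ioi fun s hs => ?_
  have h2 := ((hasSum_besselSeries hl (A * s ^ a)).mul_left
    (s ^ (a * (l + 1) - 1))).mul_right (besselSeries l (B * s ^ a) * Real.exp (-t * s ^ a))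
  rw [mul_assoc _ (besselSeries l (B * s ^ a)), ← h2.tsum_eq]
  refine tsum_congr fun k => ?_
  rw [← mul_div_assoc, rpow_mul_pow_rpow hs]
  ring_nf

end DeformedHeat

/-! ### Gegenbauer polynomials through their coefficients and generating function. -/

namespace DeformedHeat

open MeasureTheory Filter Topology

/-- The coefficient of `u ^ i` (with `i + 2 * j = m`) in the Gegenbauer polynomial of degree `m`
and order `r`. -/
noncomputable def gegenbauerCoeff (r : ℝ) (m j : ℕ) : ℝ :=
  if 2 * j ≤ m then (-1) ^ j * (ascPochhammer ℝ (m - j)).eval r * 2 ^ (m - 2 * j) /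
    ((m - 2 * j)! * j !) else 0

/-- The Gegenbauer polynomial of degree `m` and order `r`. -/
noncomputable def gegenbauer (r : ℝ) (m : ℕ) (u : ℝ) : ℝ :=
  ∑ j ∈ Finset.range (m + 1), gegenbauerCoeff r m j * u ^ (m - 2 * j)

theorem gegenbauerCoeff_of_lt {r : ℝ} {m j : ℕ} (h : m < 2 * j) : gegenbauerCoeff r m j = 0 :=
  if_neg (by omega)

theorem gegenbauerCoeff_add (r : ℝ) (i j : ℕ) : gegenbauerCoeff r (i + 2 * j) j =
    (-1) ^ j * (ascPochhammer ℝ (i + j)).eval r * 2 ^ i / (i ! * j !) := by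
  rw [gegenbauerCoeff, if_pos (by omega), show i + 2 * j - j = i + j by omega,
    show i + 2 * j - 2 * j = i by omega]

theorem gegenbauer_eq_sum {r : ℝ} {m n : ℕ} (h : m < n) (u : ℝ) :
    gegenbauer r m u = ∑ j ∈ Finset.range n, gegenbauerCoeff r m j * u ^ (m - 2 * j) := by
  refine Finset.sum_subset (by simpa using h) fun j _ hj => ?_
  rw [gegenbauerCoeff_of_lt, zero_mul]
  simp at hj
  omega

theorem gegenbauerCoeff_zero_right (r : ℝ) (m : ℕ) :
    gegenbauerCoeff r m 0 = (ascPochhammer ℝ m).eval r * 2 ^ m / m ! := by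
  simp [gegenbauerCoeff]

theorem gegenbauerCoeff_recurrence (r u : ℝ) (m j : ℕ) :
    (m + 2) * (gegenbauerCoeff r (m + 2) (j + 1) * u ^ (m + 2 - 2 * (j + 1))) =
      2 * (m + 1 + r) * u * (gegenbauerCoeff r (m + 1) (j + 1) * u ^ (m + 1 - 2 * (j + 1))) -
        (m + 2 * r) * (gegenbauerCoeff r m j * u ^ (m - 2 * j)) := by
  have hj : ((j + 1)! : ℝ) = (j + 1) * j ! := by rw [Nat.factorial_succ]; push_cast; ring
  rcases lt_trichotomy m (2 * j) with h | h | h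
  · rw [gegenbauerCoeff_of_lt (by omega), gegenbauerCoeff_of_lt (by omega),
      gegenbauerCoeff_of_lt (by omega)]
    ring
  · obtain rfl : m = 0 + 2 * j := by omega
    rw [gegenbauerCoeff_add, show 0 + 2 * j + 2 = 0 + 2 * (j + 1) by ring, gegenbauerCoeff_add,
      gegenbauerCoeff_of_lt (by omega : 0 + 2 * j + 1 < _)]
    simp only [zero_add, hj, Nat.sub_self, pow_zero, pow_succ, ascPochhammer_succ_eval]
    push_cast
    field_simp
    ring
  · obtain ⟨i, rfl⟩ : ∃ i, m = (i + 1) + 2 * j := ⟨m - 1 - 2 * j, by omega⟩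
    have e1 : i + 1 + 2 * j + 2 = (i + 1) + 2 * (j + 1) := by ring
    have e2 : i + 1 + 2 * j + 1 = i + 2 * (j + 1) := by ring
    rw [gegenbauerCoeff_add, e1, e2, gegenbauerCoeff_add, gegenbauerCoeff_add,
      show i + 2 * (j + 1) - 2 * (j + 1) = i by omega,
      show i + 1 + 2 * (j + 1) - 2 * (j + 1) = i + 1 by omega,
      show i + 1 + 2 * j - 2 * j = i + 1 by omega,
      show i + 1 + (j + 1) = i + j + 1 + 1 by ring, show i + (j + 1) = i + j + 1 by ring,
      show i + 1 + j = i + j + 1 by ring]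
    have hi : ((i + 1)! : ℝ) = (i + 1) * i ! := by rw [Nat.factorial_succ]; push_cast; ring
    simp only [hi, hj, pow_succ, ascPochhammer_succ_eval]
    push_cast
    field_simp
    ring

theorem gegenbauer_zero (r u : ℝ) : gegenbauer r 0 u = 1 := by
  simp [gegenbauer, gegenbauerCoeff]

theorem gegenbauer_one (r u : ℝ) : gegenbauer r 1 u = 2 * r * u := by
  simp [gegenbauer, gegenbauerCoeff, Finset.sum_range_succ, mul_comm r]

theorem gegenbauer_recurrence (r u : ℝ) (m : ℕ) :
    (m + 2) * gegenbauer r (m + 2) u =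
      2 * (m + 1 + r) * u * gegenbauer r (m + 1) u - (m + 2 * r) * gegenbauer r m u := by
  rw [gegenbauer_eq_sum (lt_add_one _), gegenbauer_eq_sum (by omega : m + 1 < m + 2 + 1),
    gegenbauer_eq_sum (by omega : m < m + 2), Finset.sum_range_succ' _ (m + 2),
    Finset.sum_range_succ' _ (m + 2), mul_add, mul_add, Finset.mul_sum, Finset.mul_sum,
    Finset.mul_sum, add_sub_right_comm,
    ← Finset.sum_sub_distrib]
  congr 1
  · exact Finset.sum_congr rfl fun j _ => gegenbauerCoeff_recurrence r u m j
  · rw [gegenbauerCoeff_zero_right, gegenbauerCoeff_zero_right, Nat.factorial_succ (m + 1),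
      ascPochhammer_succ_eval]
    simp only [mul_zero, Nat.sub_zero, pow_succ]
    push_cast
    field_simp
    ring

/-- Any bound exponential in m will do, because Γ(l_m + 1) grows faster; the recurrence supplies
this crude one. -/
theorem abs_gegenbauer_le {r : ℝ} (hr : 0 ≤ r) {u : ℝ} (hu : |u| ≤ 1) (m : ℕ) :
    |gegenbauer r m u| ≤ (3 * (1 + r)) ^ m := by
  induction m using Nat.twoStepInduction with
  | zero => simp [gegenbauer_zero]
  | one =>
    rw [gegenbauer_one, abs_mul, abs_of_nonneg (by positivity : 0 ≤ 2 * r), pow_one]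
    nlinarith
  | more m h0 h1 =>
    have hm := Nat.cast_nonneg (α := ℝ) m
    set K := 3 * (1 + r)
    have hK : 1 ≤ K := by simp only [K]; linarith
    have hpow : K ^ m ≤ K ^ (m + 1) := pow_le_pow_right₀ hK (by omega)
    have h2 : |(m + 2) * gegenbauer r (m + 2) u| ≤
        2 * (m + 1 + r) * K ^ (m + 1) + (m + 2 * r) * K ^ (m + 1) := by
      rw [gegenbauer_recurrence]
      refine (abs_sub _ _).trans (add_le_add ?_ ?_)
      · rw [abs_mul, abs_mul, abs_of_nonneg (by positivity : 0 ≤ 2 * (m + 1 + r))]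
        calc _ ≤ 2 * (m + 1 + r) * 1 * K ^ (m + 1) := by gcongr
          _ = _ := by ring
      · rw [abs_mul, abs_of_nonneg (by positivity : 0 ≤ m + 2 * r)]
        gcongr
        exact h0.trans hpow
    rw [abs_mul, abs_of_nonneg (by positivity : (0 : ℝ) ≤ m + 2)] at h2
    refine le_of_mul_le_mul_left (h2.trans ?_) (by positivity : (0 : ℝ) < m + 2)
    rw [← add_mul, pow_succ K (m + 1), ← mul_assoc, mul_right_comm]
    gcongr
    simp only [K]
    nlinarith


/-- The coefficient of `u ^ i` (with `i + 2 * j = m`) in the normalized Gegenbauer polynomial of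
degree `m` and index `r - 1`. -/
noncomputable def zonalCoeff (r : ℝ) (m j : ℕ) : ℝ :=
  if j = 0 then gegenbauerCoeff r m 0
  else if m < 2 then 0 else gegenbauerCoeff r m j - gegenbauerCoeff r (m - 2) (j - 1)

theorem zonalCoeff_zero_right (r : ℝ) (m : ℕ) :
    zonalCoeff r m 0 = (ascPochhammer ℝ m).eval r * 2 ^ m / m ! := by
  rw [zonalCoeff, if_pos rfl, gegenbauerCoeff_zero_right]

theorem zonalCoeff_of_lt {r : ℝ} {m j : ℕ} (h : m < 2 * j) : zonalCoeff r m j = 0 := by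
  rw [zonalCoeff, if_neg (by omega)]
  split_ifs with h2
  · rfl
  · rw [gegenbauerCoeff_of_lt h, gegenbauerCoeff_of_lt (by omega), sub_zero]

/-- Expressing the coefficients through order r = ν + 1 avoids the usual factor (m + ν)/ν, which is
meaningless at ν = 0, that is for N = 2. -/
theorem zonalCoeff_add (r : ℝ) (i j : ℕ) : zonalCoeff r (i + 2 * (j + 1)) (j + 1) =
    (-1) ^ (j + 1) * (ascPochhammer ℝ (i + j)).eval r * (r + i + 2 * j + 1) * 2 ^ i /
      (i ! * (j + 1)!) := by
  rw [zonalCoeff, if_neg (by omega), if_neg (by omega), gegenbauerCoeff_add,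
    show i + 2 * (j + 1) - 2 = i + 2 * j by omega, Nat.add_sub_cancel, gegenbauerCoeff_add,
    ← add_assoc i j 1, ascPochhammer_succ_eval, Nat.factorial_succ j, pow_succ]
  push_cast
  field_simp
  ring

/-- This two-term relation is the one that harmonicity imposes on the coefficients when r = N/2. -/
theorem zonalCoeff_succ (r : ℝ) (m j : ℕ) (h : 2 * (j + 1) ≤ m) :
    zonalCoeff r m (j + 1) * (4 * (j + 1) * (r + (m - 2 * (j + 1) : ℕ) + j)) =
      -(zonalCoeff r m j * ((m - 2 * j : ℕ) * (m - 2 * j - 1 : ℕ))) := by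
  obtain ⟨i, rfl⟩ : ∃ i, m = i + 2 * (j + 1) := ⟨m - 2 * (j + 1), by omega⟩
  rw [zonalCoeff_add, show i + 2 * (j + 1) - 2 * (j + 1) = i by omega,
    show i + 2 * (j + 1) - 2 * j - 1 = i + 1 by omega,
    show i + 2 * (j + 1) - 2 * j = i + 2 by omega]
  have hi : ((i + 2)! : ℝ) = (i + 2) * (i + 1) * i ! := by
    rw [Nat.factorial_succ, Nat.factorial_succ]; push_cast; ring
  cases j with
  | zero =>
    rw [zero_add, mul_one, zonalCoeff_zero_right, hi]
    simp only [ascPochhammer_succ_eval, add_zero, pow_succ, Nat.factorial]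
    push_cast
    field_simp
    ring
  | succ j =>
    rw [show i + 2 * (j + 1 + 1) = (i + 2) + 2 * (j + 1) by ring, zonalCoeff_add, hi,
      show i + 2 + j = i + (j + 1) + 1 by ring, ascPochhammer_succ_eval,
      Nat.factorial_succ (j + 1)]
    simp only [pow_succ]
    push_cast
    field_simp
    ring

theorem sum_zonalCoeff (r : ℝ) (m : ℕ) (u : ℝ) :
    ∑ j ∈ Finset.range (m + 1), zonalCoeff r m j * u ^ (m - 2 * j) =
      gegenbauer r m u - if m < 2 then 0 else gegenbauer r (m - 2) u := by
  rw [Finset.sum_range_succ', gegenbauer, Finset.sum_range_succ' _ m, add_sub_right_comm]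
  congr 1
  split_ifs with h
  · rw [sub_zero]
    refine Finset.sum_congr rfl fun j _ => ?_
    rw [zonalCoeff_of_lt (by omega), gegenbauerCoeff_of_lt (by omega)]
  · rw [gegenbauer_eq_sum (by omega : m - 2 < m), ← Finset.sum_sub_distrib]
    refine Finset.sum_congr rfl fun j _ => ?_
    rw [zonalCoeff, if_neg (by omega), if_neg h, Nat.add_sub_cancel, sub_mul,
      show m - 2 - 2 * j = m - 2 * (j + 1) by omega]

theorem iteratedDeriv_id_mul {g : ℝ → ℝ} (hg : AnalyticAt ℝ g 0) (n : ℕ) :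
    iteratedDeriv n (fun x => x * g x) 0 = n * iteratedDeriv (n - 1) g 0 := by
  rw [iteratedDeriv_fun_mul (f := fun x => x) contDiffAt_fun_id hg.contDiffAt]
  cases n with
  | zero => simp
  | succ n =>
    rw [Finset.sum_eq_single 1]
    · simp [iteratedDeriv_fun_id_zero]
    · intro b _ hb
      simp [iteratedDeriv_fun_id_zero, hb]
    · simp

theorem iteratedDeriv_rpow_eq_gegenbauer (r u : ℝ) (m : ℕ) :
    iteratedDeriv m (fun x : ℝ => (1 - 2 * u * x + x ^ 2) ^ (-r)) 0 = m ! * gegenbauer r m u := by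
  set f : ℝ → ℝ := fun x => (1 - 2 * u * x + x ^ 2) ^ (-r) with hf_def
  have hf : AnalyticAt ℝ f 0 := by
    exact ContDiffAt.analyticAt (ContDiffAt.rpow_const_of_ne (by fun_prop) (by simp))
  have hpos : ∀ᶠ x : ℝ in 𝓝 0, 0 < 1 - 2 * u * x + x ^ 2 :=
    ContinuousAt.eventually_lt (by fun_prop) (by fun_prop) (by simp)
  -- The differential equation (1 - 2ux + x²) f' = 2r(u - x) f, solved for f'. Differentiating it n
  -- times at 0 gives the Gegenbauer recurrence.
  have hder : ∀ᶠ x : ℝ in 𝓝 0, deriv f x =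
      (2 * u) * (x * deriv f x) - x * (x * deriv f x) +
        ((2 * r * u) * f x - 2 * r * (x * f x)) := by
    filter_upwards [hpos] with x hx
    have h1 : HasDerivAt (fun x : ℝ => 1 - 2 * u * x + x ^ 2) (-(2 * u) + 2 * x) x := by
      have := (((hasDerivAt_id x).const_mul (2 * u)).const_sub 1).add (hasDerivAt_pow 2 x)
      exact this.congr_deriv (by simp)
    have h2 := (h1.rpow_const (p := -r) (Or.inl hx.ne')).deriv
    have h3 : (1 - 2 * u * x + x ^ 2) ^ (-r) =
        (1 - 2 * u * x + x ^ 2) ^ (-r - 1) * (1 - 2 * u * x + x ^ 2) := by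
      rw [← Real.rpow_add_one hx.ne']; ring_nf
    rw [hf_def, h2]
    simp only [h3]
    ring
  have hrec : ∀ n : ℕ, iteratedDeriv (n + 1) f 0 =
      (2 * u) * (n * iteratedDeriv (n - 1 + 1) f 0) -
        n * ((n - 1 : ℕ) * iteratedDeriv (n - 1 - 1 + 1) f 0) +
        ((2 * r * u) * iteratedDeriv n f 0 - 2 * r * (n * iteratedDeriv (n - 1) f 0)) := by
    intro n
    have hd := hf.deriv
    simp only [iteratedDeriv_succ']
    have hx : AnalyticAt ℝ (fun x : ℝ => x) 0 := analyticAt_id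
    have h1 : AnalyticAt ℝ (fun x => x * deriv f x) 0 := hx.mul hd
    have h2 : AnalyticAt ℝ (fun x => x * (x * deriv f x)) 0 := hx.mul h1
    have h3 : AnalyticAt ℝ (fun x => x * f x) 0 := hx.mul hf
    have g1 : AnalyticAt ℝ (fun x => 2 * u * (x * deriv f x)) 0 := analyticAt_const.mul h1
    have g2 : AnalyticAt ℝ (fun x => 2 * r * u * f x) 0 := analyticAt_const.mul hf
    have g3 : AnalyticAt ℝ (fun x => 2 * r * (x * f x)) 0 := analyticAt_const.mul h3
    have g4 : AnalyticAt ℝ (fun x => 2 * u * (x * deriv f x) - x * (x * deriv f x)) 0 := g1.sub h2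
    have g5 : AnalyticAt ℝ (fun x => 2 * r * u * f x - 2 * r * (x * f x)) 0 := g2.sub g3
    rw [Filter.EventuallyEq.iteratedDeriv_eq n hder,
      iteratedDeriv_fun_add g4.contDiffAt g5.contDiffAt,
      iteratedDeriv_fun_sub g1.contDiffAt h2.contDiffAt,
      iteratedDeriv_fun_sub g2.contDiffAt g3.contDiffAt, iteratedDeriv_const_mul_field,
      iteratedDeriv_const_mul_field, iteratedDeriv_const_mul_field, iteratedDeriv_id_mul hd,
      iteratedDeriv_id_mul h1, iteratedDeriv_id_mul hd, iteratedDeriv_id_mul hf]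
  induction m using Nat.twoStepInduction with
  | zero => simp [hf_def, gegenbauer_zero]
  | one =>
    rw [show (1 : ℕ) = 0 + 1 from rfl, hrec 0, gegenbauer_one]
    simp [hf_def]
  | more m h0 h1 =>
    have h2 := gegenbauer_recurrence r u m
    have h3 : (m + 1 : ℕ) * ((m : ℕ) * iteratedDeriv (m - 1 + 1) f 0) =
        (m + 1) * (m * iteratedDeriv m f 0) := by
      cases m <;> simp
    rw [hrec (m + 1), Nat.add_sub_cancel, h3, h0, h1, Nat.factorial_succ (m + 1),
      Nat.factorial_succ m]
    push_cast
    linear_combination -((m + 1) * m ! : ℝ) * h2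

/-- Multiplying the generating function by 1 - x² subtracts the coefficient two places back. -/
theorem normalizedGegenbauer_eq (v u : ℝ) (m : ℕ) :
    normalizedGegenbauer v m u =
      gegenbauer (v + 1) m u - if m < 2 then 0 else gegenbauer (v + 1) (m - 2) u := by
  set f : ℝ → ℝ := fun x => (1 - 2 * u * x + x ^ 2) ^ (-(v + 1)) with hf_def
  have hf : AnalyticAt ℝ f 0 := by
    exact ContDiffAt.analyticAt (ContDiffAt.rpow_const_of_ne (by fun_prop) (by simp))
  have hpos : ∀ᶠ x : ℝ in 𝓝 0, 0 < 1 - 2 * u * x + x ^ 2 :=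
    ContinuousAt.eventually_lt (by fun_prop) (by fun_prop) (by simp)
  have heq : (fun x : ℝ => (1 - x ^ 2) / (1 - 2 * u * x + x ^ 2) ^ (v + 1)) =ᶠ[𝓝 0]
      fun x => f x - x * (x * f x) := by
    filter_upwards [hpos] with x hx
    simp only [hf_def, Real.rpow_neg hx.le]
    ring
  have hx : AnalyticAt ℝ (fun x : ℝ => x) 0 := analyticAt_id
  have h1 : AnalyticAt ℝ (fun x => x * f x) 0 := hx.mul hf
  have h2 : AnalyticAt ℝ (fun x => x * (x * f x)) 0 := hx.mul h1
  rw [normalizedGegenbauer, Filter.EventuallyEq.iteratedDeriv_eq m heq, iteratedDeriv_fun_sub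
    hf.contDiffAt h2.contDiffAt, iteratedDeriv_id_mul h1, iteratedDeriv_id_mul hf,
    iteratedDeriv_rpow_eq_gegenbauer, iteratedDeriv_rpow_eq_gegenbauer]
  have hm : (0 : ℝ) < m ! := by positivity
  rcases m with _ | _ | m
  · simp
  · simp
  · rw [if_neg (by omega), show m + 1 + 1 - 1 - 1 = m by omega, Nat.add_sub_cancel,
      show m + 1 + 1 - 2 = m by omega, Nat.factorial_succ, Nat.factorial_succ]
    push_cast
    field_simp

theorem normalizedGegenbauer_eq_sum (v u : ℝ) (m : ℕ) :
    normalizedGegenbauer v m u =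
      ∑ j ∈ Finset.range (m + 1), zonalCoeff (v + 1) m j * u ^ (m - 2 * j) := by
  rw [normalizedGegenbauer_eq, sum_zonalCoeff]

theorem abs_normalizedGegenbauer_le {v u : ℝ} (hv : 0 ≤ v + 1) (hu : |u| ≤ 1) (m : ℕ) :
    |normalizedGegenbauer v m u| ≤ 2 * (3 * (v + 2)) ^ m := by
  have hb := abs_gegenbauer_le hv hu
  rw [show 1 + (v + 1) = v + 2 by ring] at hb
  rw [normalizedGegenbauer_eq, two_mul]
  refine (abs_sub _ _).trans (add_le_add (hb m) ?_)
  split_ifs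
  · rw [abs_zero]
    exact pow_nonneg (by linarith) _
  · exact (hb _).trans (pow_le_pow_right₀ (by linarith) (Nat.sub_le _ _))

end DeformedHeat

/-! ### Zonal solid harmonics as polynomials, and their harmonicity. -/

namespace DeformedHeat

open MeasureTheory Filter Topology

open MvPolynomial (C X pderiv)

variable {N : ℕ}

/-- The Laplacian of a polynomial. -/
noncomputable def laplacian (p : MvPolynomial (Fin N) ℝ) : MvPolynomial (Fin N) ℝ :=
  ∑ i, pderiv i (pderiv i p)

/-- The linear form with coefficients `y`. -/
noncomputable def linForm (y : Fin N → ℝ) : MvPolynomial (Fin N) ℝ := ∑ i, C (y i) * X i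

/-- The derivation along the constant vector field `y`. -/
noncomputable def dirDeriv (y : Fin N → ℝ) :
    Derivation ℝ (MvPolynomial (Fin N) ℝ) (MvPolynomial (Fin N) ℝ) := ∑ i, y i • pderiv i

/-- The quadratic form `∑ Xᵢ²`. -/
noncomputable def sqForm (N : ℕ) : MvPolynomial (Fin N) ℝ := ∑ i, X i ^ 2

theorem dirDeriv_apply (y : Fin N → ℝ) (p : MvPolynomial (Fin N) ℝ) :
    dirDeriv y p = ∑ i, C (y i) * pderiv i p := by
  rw [dirDeriv, ← Derivation.coeFnAddMonoidHom_apply, map_sum, Finset.sum_apply]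
  simp [MvPolynomial.smul_eq_C_mul]

theorem pderiv_comm (i j : Fin N) (p : MvPolynomial (Fin N) ℝ) :
    pderiv i (pderiv j p) = pderiv j (pderiv i p) := by
  -- A commutator of derivations is a derivation, so it suffices that it vanishes on the variables.
  have h : ⁅pderiv (R := ℝ) i, pderiv (R := ℝ) j⁆ = 0 := by
    refine MvPolynomial.derivation_ext fun k => ?_
    rw [Derivation.commutator_apply]
    simp [MvPolynomial.pderiv_X, Pi.single_apply, apply_ite]
  have := congrArg
    (fun D : Derivation ℝ (MvPolynomial (Fin N) ℝ) (MvPolynomial (Fin N) ℝ) => D p) h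
  rw [Derivation.commutator_apply] at this
  simpa [sub_eq_zero] using this

theorem laplacian_dirDeriv (y : Fin N → ℝ) (p : MvPolynomial (Fin N) ℝ) :
    laplacian (dirDeriv y p) = dirDeriv y (laplacian p) := by
  simp only [laplacian, dirDeriv_apply, map_sum, MvPolynomial.pderiv_C_mul]
  refine Finset.sum_congr rfl fun i _ => Finset.sum_congr rfl fun j _ => ?_
  rw [pderiv_comm i j, pderiv_comm i j]

theorem pderiv_linForm (y : Fin N → ℝ) (i : Fin N) : pderiv i (linForm y) = C (y i) := by
  simp [linForm, MvPolynomial.pderiv_X, Pi.single_apply]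

theorem pderiv_sqForm (i : Fin N) : pderiv i (sqForm N) = 2 * X i := by
  simp [sqForm, MvPolynomial.pderiv_X, Pi.single_apply]

theorem sum_X_mul_C (y : Fin N → ℝ) : ∑ i, C (y i) * X i = linForm y := rfl

theorem laplacian_mul (p q : MvPolynomial (Fin N) ℝ) :
    laplacian (p * q) = laplacian p * q + 2 * ∑ i, pderiv i p * pderiv i q + p * laplacian q := by
  simp only [laplacian, Finset.sum_mul, Finset.mul_sum, ← Finset.sum_add_distrib]
  refine Finset.sum_congr rfl fun i _ => ?_
  simp only [MvPolynomial.pderiv_mul, map_add]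
  ring

theorem laplacian_linForm_pow (y : Fin N → ℝ) (n : ℕ) :
    laplacian (linForm y ^ n) =
      C ((n : ℝ) * (n - 1 : ℕ) * ∑ i, y i ^ 2) * linForm y ^ (n - 2) := by
  simp only [laplacian, MvPolynomial.pderiv_pow, pderiv_linForm, MvPolynomial.pderiv_mul,
    MvPolynomial.pderiv_C]
  simp only [map_mul, map_sum, map_natCast, map_pow, Finset.mul_sum, Finset.sum_mul]
  refine Finset.sum_congr rfl fun i _ => ?_
  have : pderiv i (n : MvPolynomial (Fin N) ℝ) = 0 := by
    rw [← map_natCast C n, MvPolynomial.pderiv_C]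
  rw [this, Nat.sub_sub]
  ring

theorem laplacian_sqForm_pow (n : ℕ) :
    laplacian (sqForm N ^ (n + 1)) = C (2 * (n + 1) * (N + 2 * n) : ℝ) * sqForm N ^ n := by
  have h : ∀ i : Fin N, pderiv i (pderiv i (sqForm N ^ (n + 1))) =
      C (4 * (n + 1) * n : ℝ) * sqForm N ^ (n - 1) * X i ^ 2 +
        C (2 * (n + 1) : ℝ) * sqForm N ^ n := by
    intro i
    have h1 : pderiv i (sqForm N ^ (n + 1)) =
        C (2 * (n + 1) : ℝ) * (sqForm N ^ n * X i) := by
      rw [MvPolynomial.pderiv_pow, pderiv_sqForm]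
      simp only [map_mul, map_add, map_natCast, map_one, map_ofNat, Nat.add_sub_cancel]
      push_cast
      ring
    rw [h1, MvPolynomial.pderiv_C_mul, MvPolynomial.pderiv_mul, MvPolynomial.pderiv_pow,
      pderiv_sqForm, MvPolynomial.pderiv_X_self]
    simp only [map_mul, map_add, map_natCast, map_one, map_ofNat]
    ring
  simp only [laplacian, h, Finset.sum_add_distrib, ← Finset.mul_sum]
  rw [← sqForm, mul_assoc, ← pow_succ]
  simp only [Finset.sum_const, Finset.card_univ, Fintype.card_fin, nsmul_eq_mul, map_mul, map_add,
    map_natCast, map_one, map_ofNat]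
  cases n with
  | zero => simp
  | succ n =>
    rw [Nat.add_sub_cancel]
    push_cast
    ring

theorem laplacian_linForm_pow_mul_sqForm_pow (y : Fin N → ℝ) (n j : ℕ) :
    laplacian (linForm y ^ n * sqForm N ^ (j + 1)) =
      C ((n : ℝ) * (n - 1 : ℕ) * ∑ i, y i ^ 2) * linForm y ^ (n - 2) * sqForm N ^ (j + 1) +
        C (4 * (j + 1) * ((N : ℝ) / 2 + n + j)) * (linForm y ^ n * sqForm N ^ j) := by
  have h : ∑ i, pderiv i (linForm y ^ n) * pderiv i (sqForm N ^ (j + 1)) =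
      C (2 * n * (j + 1) : ℝ) * (linForm y ^ n * sqForm N ^ j) := by
    simp only [MvPolynomial.pderiv_pow, pderiv_linForm, pderiv_sqForm, Nat.add_sub_cancel]
    trans ((n : MvPolynomial (Fin N) ℝ) * linForm y ^ (n - 1) * (j + 1 : ℕ) * sqForm N ^ j * 2) *
      ∑ i, C (y i) * X i
    · rw [Finset.mul_sum]
      refine Finset.sum_congr rfl fun i _ => ?_
      ring
    · rw [sum_X_mul_C]
      simp only [map_mul, map_add, map_natCast, map_one, map_ofNat]
      cases n with
      | zero => simp
      | succ n =>
        rw [Nat.add_sub_cancel]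
        push_cast
        ring
  rw [laplacian_mul, h, laplacian_linForm_pow, laplacian_sqForm_pow, add_assoc]
  congr 1
  have e : (4 * (j + 1) * ((N : ℝ) / 2 + n + j)) = 2 * (2 * n * (j + 1)) +
    2 * (j + 1) * (N + 2 * j) := by ring
  rw [e, C.map_add, C.map_mul 2 (2 * _ * _), map_ofNat]
  ring

theorem isHomogeneous_linForm (y : Fin N → ℝ) : (linForm y).IsHomogeneous 1 :=
  MvPolynomial.IsHomogeneous.sum _ _ _ fun _ _ => MvPolynomial.isHomogeneous_C_mul_X _ _

theorem isHomogeneous_sqForm : (sqForm N).IsHomogeneous 2 :=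
  MvPolynomial.IsHomogeneous.sum _ _ _ fun _ _ => MvPolynomial.isHomogeneous_X_pow _ _

/-- The zonal solid harmonic of degree `m` with pole `y`. -/
noncomputable def zonalPoly (y : Fin N → ℝ) (m : ℕ) : MvPolynomial (Fin N) ℝ :=
  ∑ j ∈ Finset.range (m + 1), C (zonalCoeff (N / 2) m j * (∑ i, y i ^ 2) ^ j) *
    (linForm y ^ (m - 2 * j) * sqForm N ^ j)

theorem isHomogeneous_zonalPoly (y : Fin N → ℝ) (m : ℕ) : (zonalPoly y m).IsHomogeneous m := by
  refine MvPolynomial.IsHomogeneous.sum _ _ _ fun j _ => ?_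
  by_cases h : m < 2 * j
  · rw [zonalCoeff_of_lt h, zero_mul, map_zero, zero_mul]
    exact MvPolynomial.isHomogeneous_zero _ _ _
  · have h1 := ((isHomogeneous_linForm y).pow (m - 2 * j)).mul (isHomogeneous_sqForm.pow j)
    rw [show 1 * (m - 2 * j) + 2 * j = m by omega] at h1
    exact h1.C_mul _

theorem laplacian_sum {ι : Type*} (s : Finset ι) (f : ι → MvPolynomial (Fin N) ℝ) :
    laplacian (∑ j ∈ s, f j) = ∑ j ∈ s, laplacian (f j) := by
  simp only [laplacian, map_sum]
  exact Finset.sum_comm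

theorem laplacian_C_mul (c : ℝ) (p : MvPolynomial (Fin N) ℝ) :
    laplacian (C c * p) = C c * laplacian p := by
  simp only [laplacian, MvPolynomial.pderiv_C_mul, Finset.mul_sum]

theorem laplacian_zonalPoly (y : Fin N → ℝ) (m : ℕ) : laplacian (zonalPoly y m) = 0 := by
  set w : ℝ := ∑ i, y i ^ 2
  have hw : ∑ i, y i ^ 2 = w := rfl
  -- `A j` is what the Laplacian produces from the linear-form factor of the j-th summand. By the
  -- coefficient relation the other part is `-A (j - 1)`, so the sum telescopes to `A m`, which
  -- vanishes.
  set A : ℕ → MvPolynomial (Fin N) ℝ := fun j =>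
    C (zonalCoeff (N / 2) m j * w ^ j * ((m - 2 * j : ℕ) * (m - 2 * j - 1 : ℕ) * w)) *
      (linForm y ^ (m - 2 * (j + 1)) * sqForm N ^ j) with hA
  have h0 : laplacian (C (zonalCoeff (N / 2) m 0 * w ^ 0) *
      (linForm y ^ (m - 2 * 0) * sqForm N ^ 0)) = A 0 := by
    rw [laplacian_C_mul, pow_zero (sqForm N), mul_one, laplacian_linForm_pow, hw, hA]
    simp only [C.map_mul, mul_zero, Nat.sub_zero, zero_add, mul_one, pow_zero]
    ring
  have h1 : ∀ j, laplacian (C (zonalCoeff (N / 2) m (j + 1) * w ^ (j + 1)) *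
      (linForm y ^ (m - 2 * (j + 1)) * sqForm N ^ (j + 1))) = A (j + 1) - A j := by
    intro j
    rw [laplacian_C_mul, laplacian_linForm_pow_mul_sqForm_pow, mul_add, sub_eq_add_neg]
    congr 1
    · simp only [hA, C.map_mul, show m - 2 * (j + 1 + 1) = m - 2 * (j + 1) - 2 by omega]
      ring
    · simp only [hA]
      have e : zonalCoeff (N / 2) m (j + 1) * w ^ (j + 1) *
          (4 * (j + 1) * ((N : ℝ) / 2 + (m - 2 * (j + 1) : ℕ) + j)) =
          -(zonalCoeff (N / 2) m j * w ^ j * ((m - 2 * j : ℕ) * (m - 2 * j - 1 : ℕ) * w)) := by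
        by_cases h : 2 * (j + 1) ≤ m
        · linear_combination w ^ (j + 1) * zonalCoeff_succ (N / 2) m j h
        · rw [zonalCoeff_of_lt (by omega)]
          -- Past the last genuine coefficient both sides vanish: either the j-th coefficient is
          -- zero, or m - 2j is 0 or 1 and kills the product.
          rcases (by omega : m < 2 * j ∨ m = 2 * j ∨ m = 2 * j + 1) with h2 | h2 | h2
          · simp [zonalCoeff_of_lt h2]
          · simp [h2]
          · simp [h2]
      rw [← mul_assoc, ← C.map_mul, e, map_neg, neg_mul]
  have h2 : A m = 0 := by
    simp only [hA]
    rcases m with _ | m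
    · simp
    · rw [show m + 1 - 2 * (m + 1) = 0 by omega]
      simp
  rw [zonalPoly, laplacian_sum, Finset.sum_range_succ', h0, Finset.sum_congr rfl fun j _ => h1 j,
    Finset.sum_range_sub, h2]
  ring

end DeformedHeat

/-! ### Polar coordinates and Gaussian integration by parts. -/

namespace DeformedHeat

open MeasureTheory Filter Topology

open MvPolynomial (C X pderiv)

variable {N : ℕ}

theorem nontrivial_euclideanSpace (hN : 1 ≤ N) : Nontrivial (EuclideanSpace ℝ (Fin N)) := by
  have : Nonempty (Fin N) := ⟨⟨0, hN⟩⟩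
  infer_instance

theorem integrable_norm_rpow_mul_exp (hN : 1 ≤ N) {a c q : ℝ} (ha : 0 < a) (hc : 0 < c)
    (hq : -(N : ℝ) < q) :
    Integrable fun x : EuclideanSpace ℝ (Fin N) => ‖x‖ ^ q * Real.exp (-c * ‖x‖ ^ a) := by
  have := nontrivial_euclideanSpace hN
  refine (integrable_fun_norm_addHaar volume
    (f := fun s : ℝ => s ^ q * Real.exp (-c * s ^ a))).2 ?_
  refine (integrableOn_rpow_mul_exp_neg_mul_rpow (s := q + (N - 1 : ℕ)) ?_ ha hc).congr_fun ?_
    measurableSet_Ioi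
  · rw [Nat.cast_sub hN]; push_cast; linarith
  · intro s hs
    simp only [finrank_euclideanSpace, Fintype.card_fin, smul_eq_mul]
    rw [Real.rpow_add hs, Real.rpow_natCast]
    ring

/-- The integral of a polynomial over the unit sphere. -/
noncomputable def sphereIntegral (p : MvPolynomial (Fin N) ℝ) : ℝ :=
  ∫ u : Metric.sphere (0 : EuclideanSpace ℝ (Fin N)) 1,
    p.eval u.1.ofLp ∂(volume : Measure (EuclideanSpace ℝ (Fin N))).toSphere

theorem eval_smul_of_isHomogeneous {p : MvPolynomial (Fin N) ℝ} {d : ℕ} (hp : p.IsHomogeneous d)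
    (s : ℝ) (x : Fin N → ℝ) : p.eval (s • x) = s ^ d * p.eval x := by
  rw [MvPolynomial.eval_eq', MvPolynomial.eval_eq', Finset.mul_sum]
  refine Finset.sum_congr rfl fun e he => ?_
  have hd : e.degree = d := by
    by_contra h
    exact MvPolynomial.mem_support_iff.1 he (hp.coeff_eq_zero h)
  simp only [Pi.smul_apply, smul_eq_mul, mul_pow, Finset.prod_mul_distrib]
  rw [Finset.prod_pow_eq_pow_sum, ← hd, Finsupp.degree_eq_sum]
  ring

/-- Integration of a radial function times a homogeneous polynomial in polar coordinates. -/
theorem integral_radial_mul_eval (hN : 1 ≤ N) {p : MvPolynomial (Fin N) ℝ} {d : ℕ}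
    (hp : p.IsHomogeneous d) (f : ℝ → ℝ) :
    ∫ x : EuclideanSpace ℝ (Fin N), f ‖x‖ * p.eval x.ofLp =
      (∫ s in Set.Ioi (0 : ℝ), s ^ (N - 1 + d) * f s) * sphereIntegral p := by
  have := nontrivial_euclideanSpace hN
  set μ : Measure (EuclideanSpace ℝ (Fin N)) := volume
  calc ∫ x : EuclideanSpace ℝ (Fin N), f ‖x‖ * p.eval x.ofLp
      = ∫ x : ({(0)}ᶜ : Set (EuclideanSpace ℝ (Fin N))), f ‖x.1‖ * p.eval x.1.ofLp
          ∂(μ.comap (↑)) := by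
        rw [integral_subtype_comap (measurableSet_singleton _).compl
          fun x : EuclideanSpace ℝ (Fin N) => f ‖x‖ * p.eval x.ofLp,
          restrict_compl_singleton]
    _ = ∫ z : Metric.sphere (0 : EuclideanSpace ℝ (Fin N)) 1 × Set.Ioi (0 : ℝ),
          p.eval z.1.1.ofLp * (z.2.1 ^ d * f z.2.1) ∂μ.toSphere.prod
            (.volumeIoiPow (Module.finrank ℝ (EuclideanSpace ℝ (Fin N)) - 1)) := by
        rw [← μ.measurePreserving_homeomorphUnitSphereProd.integral_comp
          (Homeomorph.measurableEmbedding _)]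
        refine integral_congr_ae (ae_of_all _ fun x => ?_)
        have hx : ‖x.1‖ ≠ 0 := norm_ne_zero_iff.2 x.2
        have h1 := eval_smul_of_isHomogeneous hp ‖x.1‖ (‖x.1‖⁻¹ • x.1.ofLp)
        rw [smul_smul, mul_inv_cancel₀ hx, one_smul] at h1
        simp only [homeomorphUnitSphereProd_apply_fst_coe, homeomorphUnitSphereProd_apply_snd_coe,
          WithLp.ofLp_smul, h1]
        ring
    _ = sphereIntegral p * ∫ s : Set.Ioi (0 : ℝ), s.1 ^ d * f s
          ∂(.volumeIoiPow (Module.finrank ℝ (EuclideanSpace ℝ (Fin N)) - 1)) :=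
      integral_prod_mul (fun u : Metric.sphere (0 : EuclideanSpace ℝ (Fin N)) 1 =>
        p.eval u.1.ofLp) (fun s : Set.Ioi (0 : ℝ) => s.1 ^ d * f s)
    _ = _ := by
        rw [mul_comm]
        congr 1
        simp only [Measure.volumeIoiPow, ENNReal.ofReal]
        rw [integral_withDensity_eq_integral_smul, integral_subtype_comap measurableSet_Ioi
          fun s => Real.toNNReal (s ^ (Module.finrank ℝ (EuclideanSpace ℝ (Fin N)) - 1)) •
            (s ^ d * f s),
          setIntegral_congr_fun measurableSet_Ioi fun x hx => ?_]
        · rw [NNReal.smul_def, Real.coe_toNNReal _ (pow_nonneg (le_of_lt hx) _), smul_eq_mul,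
            pow_add, finrank_euclideanSpace, Fintype.card_fin]
          ring
        · exact (measurable_subtype_coe.pow_const _).real_toNNReal

theorem exists_abs_eval_le (p : MvPolynomial (Fin N) ℝ) :
    ∃ K : ℝ, ∃ k : ℕ, ∀ x : EuclideanSpace ℝ (Fin N), |p.eval x.ofLp| ≤ K * (1 + ‖x‖) ^ k := by
  induction p using MvPolynomial.induction_on with
  | C c => exact ⟨|c|, 0, fun x => by simp⟩
  | add p q hp hq =>
    obtain ⟨K, k, h⟩ := hp
    obtain ⟨L, l, h'⟩ := hq
    refine ⟨|K| + |L|, k + l, fun x => ?_⟩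
    have h1 : 1 ≤ 1 + ‖x‖ := by linarith [norm_nonneg x]
    rw [map_add]
    refine (abs_add_le _ _).trans ?_
    rw [add_mul]
    refine add_le_add ((h x).trans ?_) ((h' x).trans ?_)
    · exact mul_le_mul (le_abs_self _) (pow_le_pow_right₀ h1 (by omega)) (by positivity)
        (abs_nonneg _)
    · exact mul_le_mul (le_abs_self _) (pow_le_pow_right₀ h1 (by omega)) (by positivity)
        (abs_nonneg _)
  | mul_X p i hp =>
    obtain ⟨K, k, h⟩ := hp
    refine ⟨K, k + 1, fun x => ?_⟩
    have h1 : |x.ofLp i| ≤ 1 + ‖x‖ := by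
      have := PiLp.norm_apply_le x i
      rw [Real.norm_eq_abs] at this
      linarith
    rw [map_mul, MvPolynomial.eval_X, abs_mul, pow_succ, ← mul_assoc]
    exact mul_le_mul (h x) h1 (abs_nonneg _) ((abs_nonneg _).trans (h x))

theorem continuous_eval_ofLp (p : MvPolynomial (Fin N) ℝ) :
    Continuous fun x : EuclideanSpace ℝ (Fin N) => p.eval x.ofLp :=
  (MvPolynomial.continuous_eval p).comp (PiLp.continuous_ofLp 2 _)

theorem integrable_eval_mul_gaussian (hN : 1 ≤ N) (p : MvPolynomial (Fin N) ℝ) :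
    Integrable fun x : EuclideanSpace ℝ (Fin N) =>
      p.eval x.ofLp * Real.exp (-‖x‖ ^ 2 / 2) := by
  obtain ⟨K, k, h⟩ := exists_abs_eval_le p
  have h0 := integrable_norm_rpow_mul_exp hN (a := 2) (c := 1 / 4) (q := 0) two_pos (by norm_num)
    (by simp; omega)
  refine (h0.const_mul (|K| * (k ! * Real.exp 2))).mono'
    ((continuous_eval_ofLp p).mul (by fun_prop)).aestronglyMeasurable (ae_of_all _ fun x => ?_)
  have h1 : (1 + ‖x‖) ^ k ≤ k ! * Real.exp (1 + ‖x‖) := by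
    have := Real.pow_div_factorial_le_exp (1 + ‖x‖) (by positivity) k
    rwa [div_le_iff₀' (by positivity)] at this
  -- Comparing exponents, 1 + s - s²/2 ≤ 2 - s²/4 is (s - 2)² ≥ 0.
  have h2 : Real.exp (1 + ‖x‖) * Real.exp (-‖x‖ ^ 2 / 2) ≤
      Real.exp 2 * Real.exp (-(1 / 4) * ‖x‖ ^ (2 : ℝ)) := by
    rw [← Real.exp_add, ← Real.exp_add, Real.exp_le_exp, Real.rpow_two]
    nlinarith [sq_nonneg (‖x‖ - 2)]
  rw [norm_mul, Real.norm_eq_abs, Real.norm_of_nonneg (Real.exp_pos _).le, Real.rpow_zero, one_mul]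
  calc |p.eval x.ofLp| * Real.exp (-‖x‖ ^ 2 / 2)
      ≤ (|K| * (k ! * Real.exp (1 + ‖x‖))) * Real.exp (-‖x‖ ^ 2 / 2) := by
        gcongr
        refine (h x).trans ?_
        gcongr
        exact le_abs_self _
    _ = |K| * k ! * (Real.exp (1 + ‖x‖) * Real.exp (-‖x‖ ^ 2 / 2)) := by ring
    _ ≤ |K| * k ! * (Real.exp 2 * Real.exp (-(1 / 4) * ‖x‖ ^ (2 : ℝ))) := by gcongr
    _ = _ := by ring

/-- The (unnormalized) Gaussian integral of a polynomial. -/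
noncomputable def gaussIntegral (p : MvPolynomial (Fin N) ℝ) : ℝ :=
  ∫ x : EuclideanSpace ℝ (Fin N), p.eval x.ofLp * Real.exp (-‖x‖ ^ 2 / 2)

theorem hasLineDerivAt_eval (p : MvPolynomial (Fin N) ℝ) (i : Fin N)
    (x : EuclideanSpace ℝ (Fin N)) :
    HasLineDerivAt ℝ (fun x : EuclideanSpace ℝ (Fin N) => p.eval x.ofLp)
      ((pderiv i p).eval x.ofLp) x (EuclideanSpace.single i 1) := by
  rw [HasLineDerivAt]
  induction p using MvPolynomial.induction_on with
  | C c => simpa using hasDerivAt_const (0 : ℝ) c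
  | add p q hp hq =>
    simp only [map_add]
    exact hp.add hq
  | mul_X p j hp =>
    have h1 : HasDerivAt (fun t : ℝ => (x + t • EuclideanSpace.single i (1 : ℝ)).ofLp j)
        (if j = i then 1 else 0) 0 := by
      have := ((hasDerivAt_id (0 : ℝ)).mul_const (if j = i then (1 : ℝ) else 0)).const_add
        (x.ofLp j)
      simpa [Pi.single_apply] using this
    have h2 := hp.mul h1
    simp only [zero_smul, add_zero] at h2
    simp only [map_mul, MvPolynomial.eval_X]
    refine h2.congr_deriv ?_
    rw [MvPolynomial.pderiv_mul]
    by_cases h : j = i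
    · subst h
      simp
    · simp [MvPolynomial.pderiv_X_of_ne h, h]

theorem hasLineDerivAt_gaussian (i : Fin N) (x : EuclideanSpace ℝ (Fin N)) :
    HasLineDerivAt ℝ (fun x : EuclideanSpace ℝ (Fin N) => Real.exp (-‖x‖ ^ 2 / 2))
      (-x.ofLp i * Real.exp (-‖x‖ ^ 2 / 2)) x (EuclideanSpace.single i 1) := by
  have h : (fun x : EuclideanSpace ℝ (Fin N) => Real.exp (-‖x‖ ^ 2 / 2)) = fun x =>
      Real.exp (-((sqForm N).eval x.ofLp) / 2) := by
    funext x
    rw [EuclideanSpace.norm_sq_eq]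
    simp [sqForm]
  have h1 := hasLineDerivAt_eval (sqForm N) i x
  rw [h, congrFun h x]
  rw [HasLineDerivAt] at h1 ⊢
  refine (h1.neg.div_const 2).exp.congr_deriv ?_
  simp [pderiv_sqForm]
  ring

theorem gaussIntegral_X_mul (hN : 1 ≤ N) (i : Fin N) (p : MvPolynomial (Fin N) ℝ) :
    gaussIntegral (X i * p) = gaussIntegral (pderiv i p) := by
  have h := integral_bilinear_hasLineDerivAt_right_eq_neg_left_of_integrable
    (μ := (volume : Measure (EuclideanSpace ℝ (Fin N)))) (B := ContinuousLinearMap.mul ℝ ℝ)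
    (f := fun x : EuclideanSpace ℝ (Fin N) => p.eval x.ofLp)
    (g := fun x : EuclideanSpace ℝ (Fin N) => Real.exp (-‖x‖ ^ 2 / 2))
    (f' := fun x => (pderiv i p).eval x.ofLp)
    (g' := fun x => -x.ofLp i * Real.exp (-‖x‖ ^ 2 / 2)) (v := EuclideanSpace.single i 1)
    (integrable_eval_mul_gaussian hN _) ?_ (integrable_eval_mul_gaussian hN _)
    (fun x _ => hasLineDerivAt_eval p i x) (fun x _ => hasLineDerivAt_gaussian i x)
  · simp only [ContinuousLinearMap.mul_apply'] at h
    rw [gaussIntegral, gaussIntegral, ← neg_eq_iff_eq_neg.2 h, ← integral_neg]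
    refine integral_congr_ae (ae_of_all _ fun x => ?_)
    simp
    ring
  · refine (integrable_eval_mul_gaussian hN (-(X i * p))).congr (ae_of_all _ fun x => ?_)
    simp
    ring

theorem gaussIntegral_add (hN : 1 ≤ N) (p q : MvPolynomial (Fin N) ℝ) :
    gaussIntegral (p + q) = gaussIntegral p + gaussIntegral q := by
  rw [gaussIntegral, gaussIntegral, gaussIntegral, ← integral_add
    (integrable_eval_mul_gaussian hN p) (integrable_eval_mul_gaussian hN q)]
  simp only [map_add, add_mul]

theorem gaussIntegral_C_mul (c : ℝ) (p : MvPolynomial (Fin N) ℝ) :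
    gaussIntegral (C c * p) = c * gaussIntegral p := by
  rw [gaussIntegral, gaussIntegral, ← integral_const_mul]
  simp only [map_mul, MvPolynomial.eval_C, mul_assoc]

theorem gaussIntegral_sum (hN : 1 ≤ N) {ι : Type*} (s : Finset ι)
    (f : ι → MvPolynomial (Fin N) ℝ) :
    gaussIntegral (∑ j ∈ s, f j) = ∑ j ∈ s, gaussIntegral (f j) := by
  classical
  induction s using Finset.induction_on with
  | empty => simp [gaussIntegral]
  | insert j s hj ih => rw [Finset.sum_insert hj, Finset.sum_insert hj, gaussIntegral_add hN, ih]

theorem gaussIntegral_linForm_mul (hN : 1 ≤ N) (y : Fin N → ℝ) (p : MvPolynomial (Fin N) ℝ) :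
    gaussIntegral (linForm y * p) = gaussIntegral (dirDeriv y p) := by
  rw [linForm, Finset.sum_mul, gaussIntegral_sum hN, dirDeriv_apply, gaussIntegral_sum hN]
  refine Finset.sum_congr rfl fun i _ => ?_
  rw [mul_assoc, gaussIntegral_C_mul, gaussIntegral_C_mul, gaussIntegral_X_mul hN]

/-- Integration by parts moves one factor of each Xᵢ² to a derivative; Euler's identity then counts
N + d. -/
theorem gaussIntegral_sqForm_mul (hN : 1 ≤ N) {p : MvPolynomial (Fin N) ℝ} {d : ℕ}
    (hp : p.IsHomogeneous d) : gaussIntegral (sqForm N * p) = (N + d) * gaussIntegral p := by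
  have h : ∑ i, pderiv i (X i * p) = C ((N : ℝ) + d) * p := by
    simp only [MvPolynomial.pderiv_mul, MvPolynomial.pderiv_X_self, Finset.sum_add_distrib,
      hp.sum_X_mul_pderiv]
    simp
    ring
  rw [← gaussIntegral_C_mul, ← h, gaussIntegral_sum hN, sqForm, Finset.sum_mul,
    gaussIntegral_sum hN]
  refine Finset.sum_congr rfl fun i _ => ?_
  rw [pow_two, mul_assoc, gaussIntegral_X_mul hN]

/-- Euler's identity writes n q as ∑ Xᵢ ∂ᵢq, and integration by parts turns this into the integral
of the Laplacian. -/
theorem gaussIntegral_harmonic (hN : 1 ≤ N) {q : MvPolynomial (Fin N) ℝ} {n : ℕ}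
    (hq : q.IsHomogeneous n) (hL : laplacian q = 0) (hn : n ≠ 0) : gaussIntegral q = 0 := by
  have h1 : gaussIntegral (n • q) = gaussIntegral (laplacian q) := by
    rw [← hq.sum_X_mul_pderiv, gaussIntegral_sum hN, laplacian, gaussIntegral_sum hN]
    exact Finset.sum_congr rfl fun i _ => gaussIntegral_X_mul hN i _
  rw [hL, nsmul_eq_mul, ← map_natCast C n, gaussIntegral_C_mul] at h1
  have h2 : gaussIntegral (0 : MvPolynomial (Fin N) ℝ) = 0 := by simp [gaussIntegral]
  rw [h2] at h1
  exact (mul_eq_zero.1 h1).resolve_left (by exact_mod_cast hn)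

theorem isHomogeneous_dirDeriv {q : MvPolynomial (Fin N) ℝ} {n : ℕ} (hq : q.IsHomogeneous n)
    (y : Fin N → ℝ) : (dirDeriv y q).IsHomogeneous (n - 1) := by
  rw [dirDeriv_apply]
  exact MvPolynomial.IsHomogeneous.sum _ _ _ fun i _ => hq.pderiv.C_mul _

theorem eval_dirDeriv_self {q : MvPolynomial (Fin N) ℝ} {n : ℕ} (hq : q.IsHomogeneous n)
    (y : Fin N → ℝ) : (dirDeriv y q).eval y = n * q.eval y := by
  have h := congrArg (MvPolynomial.eval y) hq.sum_X_mul_pderiv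
  simpa [dirDeriv_apply, map_sum] using h

theorem dirDeriv_linForm (y : Fin N → ℝ) : dirDeriv y (linForm y) = C (∑ i, y i ^ 2) := by
  simp only [dirDeriv_apply, pderiv_linForm, ← C.map_mul, map_sum, pow_two]

/-- A harmonic homogeneous polynomial of degree `n` is orthogonal to the powers of a linear form of
degree less than `n`, and the power of degree `n` reproduces it. -/
theorem gaussIntegral_harmonic_mul_linForm_pow (hN : 1 ≤ N) (y : Fin N → ℝ) (k : ℕ) :
    ∀ (n : ℕ) (q : MvPolynomial (Fin N) ℝ), q.IsHomogeneous n → laplacian q = 0 → k ≤ n →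
      gaussIntegral (q * linForm y ^ k) =
        if k = n then n ! * q.eval y * gaussIntegral (1 : MvPolynomial (Fin N) ℝ) else 0 := by
  induction k using Nat.strong_induction_on with
  | _ k ih =>
    intro n q hq hL hk
    rcases k with _ | k
    · rw [pow_zero, mul_one]
      rcases eq_or_ne n 0 with rfl | hn
      · have h1 := MvPolynomial.totalDegree_zero_iff_isHomogeneous (Fin N) |>.2 hq
        rw [MvPolynomial.totalDegree_eq_zero_iff_eq_C] at h1
        rw [if_pos rfl, h1, MvPolynomial.eval_C, ← mul_one (C _), gaussIntegral_C_mul]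
        simp
      · rw [if_neg hn.symm, gaussIntegral_harmonic hN hq hL hn]
    · have h1 : dirDeriv y (q * linForm y ^ k) = dirDeriv y q * linForm y ^ k +
          C (k * ∑ i, y i ^ 2) * (q * linForm y ^ (k - 1)) := by
        rw [Derivation.leibniz, Derivation.leibniz_pow, dirDeriv_linForm, C.map_mul, map_natCast]
        simp only [smul_eq_mul, nsmul_eq_mul]
        ring
      have h2 : (k : ℝ) * gaussIntegral (q * linForm y ^ (k - 1)) = 0 := by
        rcases Nat.eq_zero_or_pos k with rfl | hk0
        · simp
        · rw [ih (k - 1) (by omega) n q hq hL (by omega), if_neg (by omega), mul_zero]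
      have hL' : laplacian (dirDeriv y q) = 0 := by
        rw [laplacian_dirDeriv, hL, map_zero]
      rw [pow_succ', mul_left_comm, gaussIntegral_linForm_mul hN, h1, gaussIntegral_add hN,
        gaussIntegral_C_mul, mul_right_comm, h2, zero_mul, add_zero,
        ih k (by omega) (n - 1) _ (isHomogeneous_dirDeriv hq y) hL' (by omega),
        eval_dirDeriv_self hq]
      obtain ⟨n, rfl⟩ : ∃ n', n = n' + 1 := ⟨n - 1, by omega⟩
      simp only [Nat.add_sub_cancel, add_left_inj, Nat.factorial_succ]
      congr 1
      push_cast
      ring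

end DeformedHeat

/-! ### Orthogonality and reproducing property of zonal harmonics on the sphere. -/

namespace DeformedHeat

open MeasureTheory Filter Topology

open MvPolynomial (C X pderiv)

variable {N : ℕ}

theorem gaussIntegral_eq_mul_sphereIntegral (hN : 1 ≤ N) {p : MvPolynomial (Fin N) ℝ} {d : ℕ}
    (hp : p.IsHomogeneous d) : gaussIntegral p =
      (∫ s in Set.Ioi (0 : ℝ), s ^ (N - 1 + d) * Real.exp (-s ^ 2 / 2)) * sphereIntegral p := by
  rw [← integral_radial_mul_eval hN hp, gaussIntegral]
  simp only [mul_comm]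

theorem integral_pow_mul_gaussian_pos (k : ℕ) :
    0 < ∫ s in Set.Ioi (0 : ℝ), s ^ k * Real.exp (-s ^ 2 / 2) := by
  have h := integral_rpow_mul_exp_neg_mul_rpow (p := 2) (q := k) (b := 1 / 2) two_pos
    (by linarith [Nat.cast_nonneg (α := ℝ) k]) (by norm_num)
  have h2 : ∫ s in Set.Ioi (0 : ℝ), s ^ k * Real.exp (-s ^ 2 / 2) =
      ∫ s in Set.Ioi (0 : ℝ), s ^ (k : ℝ) * Real.exp (-(1 / 2) * s ^ (2 : ℝ)) := by
    refine setIntegral_congr_fun measurableSet_Ioi fun s _ => ?_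
    simp only [Real.rpow_natCast, Real.rpow_two]
    ring_nf
  rw [h2, h]
  have := Real.Gamma_pos_of_pos (by positivity : 0 < ((k : ℝ) + 1) / 2)
  positivity

theorem gaussIntegral_sqForm_pow_mul (hN : 1 ≤ N) {p : MvPolynomial (Fin N) ℝ} {d : ℕ}
    (hp : p.IsHomogeneous d) (j : ℕ) : gaussIntegral (sqForm N ^ j * p) =
      (∏ i ∈ Finset.range j, ((N : ℝ) + d + 2 * i)) * gaussIntegral p := by
  induction j with
  | zero => simp
  | succ j ih =>
    have h := (isHomogeneous_sqForm.pow j).mul hp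
    rw [pow_succ', mul_assoc, gaussIntegral_sqForm_mul hN h, ih, Finset.prod_range_succ]
    push_cast
    ring

theorem ascPochhammer_eval_half_mul (N n : ℕ) :
    (ascPochhammer ℝ n).eval ((N : ℝ) / 2) * 2 ^ n = ∏ i ∈ Finset.range n, ((N : ℝ) + 2 * i) := by
  induction n with
  | zero => simp
  | succ n ih =>
    rw [ascPochhammer_succ_eval, pow_succ, Finset.prod_range_succ, ← ih]
    ring

theorem eval_zonalPoly (x y : Fin N → ℝ) (m : ℕ) : (zonalPoly x m).eval y =
    ∑ j ∈ Finset.range (m + 1), zonalCoeff (N / 2) m j * (∑ i, x i * y i) ^ (m - 2 * j) *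
      ((∑ i, x i ^ 2) * ∑ i, y i ^ 2) ^ j := by
  rw [zonalPoly, map_sum]
  refine Finset.sum_congr rfl fun j _ => ?_
  simp only [linForm, sqForm, map_mul, map_pow, map_sum, MvPolynomial.eval_C, MvPolynomial.eval_X]
  ring

theorem eval_zonalPoly_comm (x y : Fin N → ℝ) (m : ℕ) :
    (zonalPoly x m).eval y = (zonalPoly y m).eval x := by
  simp only [eval_zonalPoly, mul_comm (x _), mul_comm (∑ i, x i ^ 2)]

/-- When the first factor is expanded, each power of |X|² contributes only a scalar, and the
remaining power of the linear form is orthogonal to the second factor unless it has full degree n.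
Only the leading term with m = n survives, and its coefficient (N/2)_m 2^m / m! is the normalization
that turns the factor m! into the Gaussian moment of |X|^(2m). -/
theorem gaussIntegral_zonalPoly_mul (hN : 1 ≤ N) (x y : Fin N → ℝ) {m n : ℕ} (hmn : m ≤ n) :
    gaussIntegral (zonalPoly x m * zonalPoly y n) = if m = n then
      (zonalPoly y n).eval x * gaussIntegral (sqForm N ^ n) else 0 := by
  have hZ := isHomogeneous_zonalPoly y n
  have hL := laplacian_zonalPoly y n
  have hterm : ∀ j ∈ Finset.range (m + 1), gaussIntegral
      (C (zonalCoeff (N / 2) m j * (∑ i, x i ^ 2) ^ j) *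
        (linForm x ^ (m - 2 * j) * sqForm N ^ j) * zonalPoly y n) =
      if j = 0 then (if m = n then (zonalPoly y n).eval x * gaussIntegral (sqForm N ^ n) else 0)
        else 0 := by
    intro j hj
    have e : linForm x ^ (m - 2 * j) * sqForm N ^ j * zonalPoly y n =
        sqForm N ^ j * (zonalPoly y n * linForm x ^ (m - 2 * j)) := by ring
    rw [mul_assoc, gaussIntegral_C_mul, e, gaussIntegral_sqForm_pow_mul hN
      (hZ.mul ((isHomogeneous_linForm x).pow (m - 2 * j))),
      gaussIntegral_harmonic_mul_linForm_pow hN x _ n _ hZ hL (by omega)]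
    by_cases h0 : j = 0
    · subst h0
      by_cases h1 : m = n
      · subst h1
        have h2 := gaussIntegral_sqForm_pow_mul hN (MvPolynomial.isHomogeneous_one (Fin N) ℝ) m
        rw [mul_one] at h2
        have h3 := ascPochhammer_eval_half_mul N m
        rw [if_pos rfl, if_pos rfl, if_pos (by omega), h2, zonalCoeff_zero_right]
        simp only [Nat.cast_zero, add_zero, Finset.range_zero, Finset.prod_empty, pow_zero,
          mul_one, one_mul]
        rw [← h3]
        field_simp
      · rw [if_neg h1, if_neg (by omega)]
        simp
    · rw [if_neg h0, if_neg (by simp at hj; omega)]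
      simp
  rw [zonalPoly, Finset.sum_mul, gaussIntegral_sum hN, Finset.sum_congr rfl hterm,
    Finset.sum_ite_eq' (Finset.range (m + 1)) 0]
  simp

/-- The zonal harmonics are reproducing kernels on the unit sphere. -/
theorem sphereIntegral_zonalPoly_mul (hN : 1 ≤ N) (x y : Fin N → ℝ) (m n : ℕ) :
    sphereIntegral (zonalPoly x m * zonalPoly y n) = if m = n then
      (zonalPoly x m).eval y * sphereIntegral (1 : MvPolynomial (Fin N) ℝ) else 0 := by
  wlog hmn : m ≤ n generalizing m n x y
  · rw [mul_comm, this y x n m (by omega)]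
    rcases eq_or_ne m n with rfl | h
    · simp [eval_zonalPoly_comm]
    · rw [if_neg h, if_neg h.symm]
  have h1 := gaussIntegral_zonalPoly_mul hN x y hmn
  rw [gaussIntegral_eq_mul_sphereIntegral hN
    ((isHomogeneous_zonalPoly x m).mul (isHomogeneous_zonalPoly y n))] at h1
  have hpos := (integral_pow_mul_gaussian_pos (N - 1 + (m + n))).ne'
  split_ifs with h
  · subst h
    -- Both sides are homogeneous of degree 2m, so the same radial integral cancels; on the unit
    -- sphere |X|² is 1.
    rw [if_pos rfl, gaussIntegral_eq_mul_sphereIntegral hN (isHomogeneous_sqForm.pow m),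
      two_mul m, mul_left_comm, mul_right_inj' hpos] at h1
    rw [h1, eval_zonalPoly_comm]
    congr 1
    refine integral_congr_ae (ae_of_all _ fun u => ?_)
    have h2 : ‖u.1‖ ^ 2 = 1 := by simp
    rw [EuclideanSpace.norm_sq_eq] at h2
    simp only [Real.norm_eq_abs, sq_abs] at h2
    simp [sqForm, h2]
  · rw [if_neg h] at h1
    exact (mul_eq_zero.1 h1).resolve_left hpos

/-- The kernel of the zonal solid harmonic of degree `m` on `ℝᴺ`. -/
noncomputable def zonal (m : ℕ) (x y : EuclideanSpace ℝ (Fin N)) : ℝ :=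
  (zonalPoly x.ofLp m).eval y.ofLp

theorem sum_sq_ofLp (x : EuclideanSpace ℝ (Fin N)) : ∑ i, x.ofLp i ^ 2 = ‖x‖ ^ 2 := by
  rw [EuclideanSpace.norm_sq_eq]
  simp

theorem zonal_eq_normalizedGegenbauer (m : ℕ) (x y : EuclideanSpace ℝ (Fin N)) :
    zonal m x y = (‖x‖ * ‖y‖) ^ m *
      normalizedGegenbauer (((N : ℝ) - 2) / 2) m (inner ℝ x y / (‖x‖ * ‖y‖)) := by
  have h1 : ∑ i, x.ofLp i * y.ofLp i = inner ℝ x y := by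
    rw [PiLp.inner_apply]
    simp [mul_comm]
  have h2 : ((N : ℝ) - 2) / 2 + 1 = N / 2 := by ring
  rw [zonal, eval_zonalPoly, normalizedGegenbauer_eq_sum, sum_sq_ofLp, sum_sq_ofLp, h1, h2,
    Finset.mul_sum]
  refine Finset.sum_congr rfl fun j _ => ?_
  by_cases hj : m < 2 * j
  · simp [zonalCoeff_of_lt hj]
  · obtain ⟨i, rfl⟩ : ∃ i, m = i + 2 * j := ⟨m - 2 * j, by omega⟩
    rw [Nat.add_sub_cancel]
    have h3 : (‖x‖ * ‖y‖) * (inner ℝ x y / (‖x‖ * ‖y‖)) = inner ℝ x y := by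
      -- The quotient is 0 by convention when a vector vanishes, and so is the inner product.
      by_cases h0 : ‖x‖ * ‖y‖ = 0
      · rcases mul_eq_zero.1 h0 with h | h
        · simp [norm_eq_zero.1 h]
        · simp [norm_eq_zero.1 h]
      · rw [mul_div_assoc', mul_div_cancel_left₀ _ h0]
    conv_lhs => rw [← h3]
    ring

theorem abs_zonal_le (m : ℕ) (x y : EuclideanSpace ℝ (Fin N)) :
    |zonal m x y| ≤ 2 * (3 * ((N : ℝ) / 2 + 1) * (‖x‖ * ‖y‖)) ^ m := by
  have h2 : ((N : ℝ) - 2) / 2 + 2 = N / 2 + 1 := by ring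
  have h1 := abs_normalizedGegenbauer_le (v := ((N : ℝ) - 2) / 2)
    (by linarith [Nat.cast_nonneg (α := ℝ) N]) (abs_real_inner_div_norm_mul_norm_le_one x y) m
  rw [h2] at h1
  rw [zonal_eq_normalizedGegenbauer, abs_mul, abs_of_nonneg (by positivity)]
  calc _ ≤ (‖x‖ * ‖y‖) ^ m * (2 * (3 * ((N : ℝ) / 2 + 1)) ^ m) := by gcongr
    _ = _ := by rw [mul_pow _ (‖x‖ * ‖y‖)]; ring

theorem zonal_zero (x y : EuclideanSpace ℝ (Fin N)) : zonal 0 x y = 1 := by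
  simp [zonal, eval_zonalPoly, zonalCoeff_zero_right]

theorem continuous_zonal (m : ℕ) (x : EuclideanSpace ℝ (Fin N)) : Continuous (zonal m x) :=
  continuous_eval_ofLp _

theorem integral_radial_mul_zonal_mul_zonal (hN : 1 ≤ N) (x y : EuclideanSpace ℝ (Fin N))
    (m n : ℕ) (f : ℝ → ℝ) :
    ∫ z : EuclideanSpace ℝ (Fin N), f ‖z‖ * (zonal m x z * zonal n y z) =
      if m = n then zonal m x y * (sphereIntegral (1 : MvPolynomial (Fin N) ℝ) *
        ∫ s in Set.Ioi (0 : ℝ), s ^ (N - 1 + 2 * m) * f s) else 0 := by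
  have h := integral_radial_mul_eval hN
    ((isHomogeneous_zonalPoly x.ofLp m).mul (isHomogeneous_zonalPoly y.ofLp n)) f
  simp only [map_mul] at h
  simp only [zonal]
  rw [h, sphereIntegral_zonalPoly_mul hN]
  split_ifs with hmn
  · rw [← hmn, ← two_mul]
    ring
  · rw [mul_zero]

end DeformedHeat

/-! ### Growth estimates and the real series behind the Fourier kernel. -/

namespace DeformedHeat

open MeasureTheory Filter Topology

variable {N : ℕ} {a : ℝ}

/-- On the tail (y, ∞) of the Gamma integral x^p is at least y^p, and the tail of exp(-x) has mass
exp(-y). -/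
theorem rpow_le_exp_mul_Gamma_of_nonneg {p y : ℝ} (hp : 0 ≤ p) (hy : 0 < y) :
    y ^ p ≤ Real.exp y * Real.Gamma (p + 1) := by
  have h1 : IntegrableOn (fun x : ℝ => Real.exp (-x) * x ^ (p + 1 - 1)) (Set.Ioi 0) :=
    Real.GammaIntegral_convergent (by linarith)
  have hsub : Set.Ioi y ⊆ Set.Ioi 0 := Set.Ioi_subset_Ioi hy.le
  have h2 : ∫ x in Set.Ioi y, y ^ p * Real.exp (-x) ≤ Real.Gamma (p + 1) := by
    rw [Real.Gamma_eq_integral (by linarith)]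
    refine le_trans (setIntegral_mono_on ((integrableOn_exp_neg_Ioi y).const_mul _)
      (h1.mono_set hsub) measurableSet_Ioi fun x hx => ?_)
      (setIntegral_mono_set h1 ?_ hsub.eventuallyLE)
    · rw [add_sub_cancel_right, mul_comm]
      exact mul_le_mul_of_nonneg_left (Real.rpow_le_rpow hy.le (le_of_lt hx) hp)
        (Real.exp_pos _).le
    · filter_upwards [ae_restrict_mem measurableSet_Ioi] with x hx
      exact mul_nonneg (Real.exp_pos _).le (Real.rpow_nonneg (le_of_lt hx) _)
  rw [integral_const_mul, integral_exp_neg_Ioi] at h2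
  calc y ^ p = Real.exp y * (y ^ p * Real.exp (-y)) := by
        rw [mul_left_comm, ← Real.exp_add]; simp
    _ ≤ _ := by gcongr

theorem rpow_le_exp_mul_Gamma {p y : ℝ} (hp : -1 < p) (hy : 1 ≤ y) :
    y ^ p ≤ Real.exp y * Real.Gamma (p + 1) := by
  rcases le_or_gt 0 p with h | h
  · exact rpow_le_exp_mul_Gamma_of_nonneg h (by linarith)
  · have h1 := rpow_le_exp_mul_Gamma_of_nonneg (p := p + 1) (by linarith)
      (by linarith : 0 < y)
    rw [Real.Gamma_add_one (by linarith)] at h1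
    have hG := Real.Gamma_pos_of_pos (by linarith : 0 < p + 1)
    calc y ^ p ≤ y ^ (p + 1) := Real.rpow_le_rpow_of_exponent_le hy (by linarith)
      _ ≤ Real.exp y * ((p + 1) * Real.Gamma (p + 1)) := h1
      _ ≤ Real.exp y * (1 * Real.Gamma (p + 1)) := by gcongr; linarith
      _ = _ := by rw [one_mul]

/-- It lets Γ(l_m + 1) absorb any m-th power. With b = 2/a the cost is exponential only in z^(a/2),
hence subordinate to every exp(d z^a). Adding 1 to z^(1/b) keeps the base at least 1, so negative
exponents do no harm. -/
theorem pow_le_exp_mul_Gamma {l b z : ℝ} (hl : -1 < l) (hb : 0 < b) (hz : 0 ≤ z) (m : ℕ) :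
    z ^ m ≤ Real.exp (2 * z ^ (1 / b) + 2) * Real.Gamma (l + b * m + 1) := by
  set y := z ^ (1 / b) + 1
  have hz1 : 0 ≤ z ^ (1 / b) := Real.rpow_nonneg hz _
  have hy : 1 ≤ y := by simp only [y]; linarith
  have hbm : 0 ≤ b * m := by positivity
  have h1 := rpow_le_exp_mul_Gamma (p := l + b * m) (by linarith) hy
  have h2 : z ^ m = (z ^ (1 / b)) ^ (b * m) := by
    rw [← Real.rpow_mul hz, ← Real.rpow_natCast]
    congr 1
    field_simp
  have h3 : y ≤ Real.exp y := by linarith [Real.add_one_le_exp y]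
  rw [h2]
  calc (z ^ (1 / b)) ^ (b * m) ≤ y ^ (b * m) :=
        Real.rpow_le_rpow hz1 (by simp only [y]; linarith) hbm
    _ = y ^ (l + b * m) * y ^ (-l) := by rw [← Real.rpow_add (by linarith)]; ring_nf
    _ ≤ y ^ (l + b * m) * y ^ (1 : ℝ) := by gcongr; linarith
    _ ≤ (Real.exp y * Real.Gamma (l + b * m + 1)) * Real.exp y := by
        rw [Real.rpow_one]
        gcongr
        exact mul_nonneg (Real.exp_pos _).le (Real.Gamma_pos_of_pos (by linarith)).le
    _ = Real.exp (y + y) * Real.Gamma (l + b * m + 1) := by rw [Real.exp_add y y]; ring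
    _ = _ := by rw [show y + y = 2 * z ^ (1 / b) + 2 by simp only [y]; ring]

/-- The index `2 (m + ν) / a` with `ν = (N - 2) / 2`. -/
noncomputable def besselIndex (N : ℕ) (a : ℝ) (m : ℕ) : ℝ := (2 * m + N - 2) / a

theorem besselIndex_eq (N : ℕ) (a : ℝ) (m : ℕ) :
    besselIndex N a m = besselIndex N a 0 + 2 / a * m := by
  simp only [besselIndex]
  push_cast
  ring

theorem neg_one_lt_besselIndex (ha : 0 < a) (haN : 2 - (N : ℝ) < a) (m : ℕ) :
    -1 < besselIndex N a m := by
  rw [besselIndex, lt_div_iff₀ ha]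
  linarith [Nat.cast_nonneg (α := ℝ) m]

theorem besselIndex_zero_le (ha : 0 < a) (m : ℕ) : besselIndex N a 0 ≤ besselIndex N a m := by
  rw [besselIndex_eq N a m]
  have : 0 ≤ 2 / a * m := by positivity
  linarith

/-- The summands of the series defining the Fourier kernel (`A = a`, `e = -1`) and the heat kernel
(`A = a * t`, `e = 1`). -/
noncomputable def zonalBessel (a A e : ℝ) (m : ℕ) (x y : EuclideanSpace ℝ (Fin N)) : ℝ :=
  A ^ (-(2 / a * m)) * zonal m x y *
    besselSeries (besselIndex N a m) (e * (‖x‖ * ‖y‖) ^ a / A ^ 2)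

theorem measurable_zonalBessel (ha : 0 < a) (haN : 2 - (N : ℝ) < a) (A e : ℝ) (m : ℕ)
    (x : EuclideanSpace ℝ (Fin N)) : Measurable (zonalBessel a A e m x) := by
  have h1 := (continuous_zonal m x).measurable
  have h2 := (continuous_besselSeries (neg_one_lt_besselIndex ha haN m)).measurable
  have h3 : Measurable fun y : EuclideanSpace ℝ (Fin N) =>
      besselSeries (besselIndex N a m) (e * (‖x‖ * ‖y‖) ^ a / A ^ 2) := h2.comp (by fun_prop)
  exact (h1.const_mul _).mul h3

/-- The budget d is halved: one half pays for the Bessel function, the other for the factor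
exp(2u|y|^(a/2)) that arises when Γ(l_m + 1) absorbs the power of |y| in the harmonic. -/
theorem exists_abs_zonalBessel_le (ha : 0 < a) (haN : 2 - (N : ℝ) < a) {A e d : ℝ}
    (hA : 0 < A) (he : |e| = 1) (hd : 0 < d) (x : EuclideanSpace ℝ (Fin N)) :
    ∃ K : ℝ, 0 ≤ K ∧ ∀ (m : ℕ) (y : EuclideanSpace ℝ (Fin N)),
      |zonalBessel a A e m x y| ≤ K * (1 / 2) ^ m * Real.exp (d * ‖y‖ ^ a) := by
  have hl := neg_one_lt_besselIndex (N := N) ha haN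
  set l := besselIndex N a
  set c := min 1 (1 + l 0)
  have hc : 0 < c := min_one_add_pos (hl 0)
  obtain ⟨δ, hδ, hδx⟩ : ∃ δ > 0, δ * (‖x‖ ^ a / A ^ 2) ≤ d / 2 := by
    refine ⟨d / (2 * (‖x‖ ^ a / A ^ 2 + 1)), by positivity, ?_⟩
    have : 0 ≤ ‖x‖ ^ a / A ^ 2 := by positivity
    rw [div_mul_eq_mul_div, div_le_div_iff₀ (by positivity) (by positivity)]
    nlinarith
  -- The extra factor 2 is the source of the geometric decay (1/2)^m.
  set q := 2 * A ^ (-(2 / a)) * (3 * ((N : ℝ) / 2 + 1)) * ‖x‖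
  have hq : 0 ≤ q := by positivity
  set u := q ^ (a / 2)
  refine ⟨2 * Real.exp (1 / (δ * c)) * Real.exp (2 / d * u ^ 2 + 2), by positivity, fun m y => ?_⟩
  have hG : 0 < Real.Gamma (l m + 1) := Real.Gamma_pos_of_pos (by linarith [hl m])
  have h1 := abs_zonal_le m x y
  have h2 := abs_besselSeries_le (hl m) hc (min_le_left _ _)
    ((min_le_right _ _).trans (by linarith [besselIndex_zero_le (N := N) ha m])) hδ
    (e * (‖x‖ * ‖y‖) ^ a / A ^ 2)
  have h3 : δ * |e * (‖x‖ * ‖y‖) ^ a / A ^ 2| ≤ d / 2 * ‖y‖ ^ a := by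
    rw [abs_div, abs_mul, he, one_mul, abs_of_nonneg (by positivity : 0 ≤ (‖x‖ * ‖y‖) ^ a),
      abs_of_pos (by positivity : 0 < A ^ 2), Real.mul_rpow (norm_nonneg _) (norm_nonneg _)]
    calc δ * (‖x‖ ^ a * ‖y‖ ^ a / A ^ 2) = δ * (‖x‖ ^ a / A ^ 2) * ‖y‖ ^ a := by ring
      _ ≤ _ := by gcongr
  have h4 := pow_le_exp_mul_Gamma (hl 0) (by positivity : 0 < 2 / a)
    (by positivity : 0 ≤ q * ‖y‖) m
  rw [← besselIndex_eq N a m, one_div_div, Real.mul_rpow hq (norm_nonneg _)] at h4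
  have h5 : 2 * (u * ‖y‖ ^ (a / 2)) ≤ 2 / d * u ^ 2 + d / 2 * ‖y‖ ^ a := by
    have e1 : ‖y‖ ^ a = (‖y‖ ^ (a / 2)) ^ 2 := by
      rw [← Real.rpow_natCast, ← Real.rpow_mul (norm_nonneg _)]
      congr 1
      push_cast
      ring
    have e2 : 2 / d * u ^ 2 + d / 2 * (‖y‖ ^ (a / 2)) ^ 2 - 2 * (u * ‖y‖ ^ (a / 2)) =
        1 / (2 * d) * (2 * u - d * ‖y‖ ^ (a / 2)) ^ 2 := by
      field_simp
      ring
    have e3 : 0 ≤ 1 / (2 * d) * (2 * u - d * ‖y‖ ^ (a / 2)) ^ 2 := by positivity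
    rw [e1]
    linarith
  have h6 : A ^ (-(2 / a * m)) = (A ^ (-(2 / a))) ^ m := by
    rw [← Real.rpow_natCast, ← Real.rpow_mul hA.le, neg_mul]
  have h7 : (A ^ (-(2 / a))) ^ m * (3 * ((N : ℝ) / 2 + 1) * (‖x‖ * ‖y‖)) ^ m =
      (1 / 2) ^ m * (q * ‖y‖) ^ m := by
    rw [← mul_pow, ← mul_pow]
    congr 1
    simp only [q]
    ring
  rw [zonalBessel, abs_mul, abs_mul, abs_of_pos (Real.rpow_pos_of_pos hA _), h6]
  calc (A ^ (-(2 / a))) ^ m * |zonal m x y| *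
        |besselSeries (l m) (e * (‖x‖ * ‖y‖) ^ a / A ^ 2)|
      ≤ (A ^ (-(2 / a))) ^ m * (2 * (3 * ((N : ℝ) / 2 + 1) * (‖x‖ * ‖y‖)) ^ m) *
        (Real.exp (1 / (δ * c)) / Real.Gamma (l m + 1) * Real.exp (d / 2 * ‖y‖ ^ a)) := by
        gcongr
        exact h2.trans (by gcongr)
    _ = 2 * Real.exp (1 / (δ * c)) * ((A ^ (-(2 / a))) ^ m *
        (3 * ((N : ℝ) / 2 + 1) * (‖x‖ * ‖y‖)) ^ m) * (1 / Real.Gamma (l m + 1)) *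
        Real.exp (d / 2 * ‖y‖ ^ a) := by ring
    _ = 2 * Real.exp (1 / (δ * c)) * (1 / 2) ^ m * (q * ‖y‖) ^ m *
        (1 / Real.Gamma (l m + 1)) * Real.exp (d / 2 * ‖y‖ ^ a) := by rw [h7]; ring
    _ ≤ 2 * Real.exp (1 / (δ * c)) * (1 / 2) ^ m * (Real.exp (2 / d * u ^ 2 + d / 2 * ‖y‖ ^ a + 2) *
        Real.Gamma (l m + 1)) * (1 / Real.Gamma (l m + 1)) * Real.exp (d / 2 * ‖y‖ ^ a) := by
        gcongr
        refine h4.trans ?_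
        gcongr
    _ = 2 * Real.exp (1 / (δ * c)) * (1 / 2) ^ m *
        Real.exp (2 / d * u ^ 2 + d / 2 * ‖y‖ ^ a + 2) * Real.exp (d / 2 * ‖y‖ ^ a) := by
        field_simp
    _ = 2 * Real.exp (1 / (δ * c)) * (1 / 2) ^ m *
        (Real.exp (2 / d * u ^ 2 + 2) * Real.exp (d * ‖y‖ ^ a)) := by
        rw [mul_assoc _ (Real.exp _), ← Real.exp_add, ← Real.exp_add]
        ring_nf
    _ = _ := by ring

/-- The two powers cannot simply be merged, since the law of exponents may fail at the origin; it is
applied after passing to the radial integral over s > 0. -/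
theorem integrable_norm_rpow_mul_rpow_mul_exp (hN : 1 ≤ N) {c p q : ℝ} (ha : 0 < a) (hc : 0 < c)
    (hq : -(N : ℝ) < p + q) : Integrable fun x : EuclideanSpace ℝ (Fin N) =>
      Real.exp (-c * ‖x‖ ^ a) * (‖x‖ ^ p * ‖x‖ ^ q) := by
  have := nontrivial_euclideanSpace hN
  refine (integrable_fun_norm_addHaar volume
    (f := fun s : ℝ => Real.exp (-c * s ^ a) * (s ^ p * s ^ q))).2 ?_
  refine ((integrable_fun_norm_addHaar volume
    (f := fun s : ℝ => s ^ (p + q) * Real.exp (-c * s ^ a))).1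
    (integrable_norm_rpow_mul_exp hN ha hc hq)).congr_fun ?_ measurableSet_Ioi
  intro s hs
  simp only [smul_eq_mul]
  rw [Real.rpow_add hs]
  ring

/-- The phase of the `m`-th summand of the Fourier kernel. -/
noncomputable def kernelPhase (a : ℝ) (m : ℕ) : ℂ := (-Complex.I) ^ ((2 / a * m : ℝ) : ℂ)

theorem norm_kernelPhase (a : ℝ) (m : ℕ) : ‖kernelPhase a m‖ = 1 := by
  rw [kernelPhase, Complex.norm_cpow_real]
  simp

theorem fourierKernel_eq_tsum (ha : 0 < a) (x y : EuclideanSpace ℝ (Fin N)) :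
    fourierKernel a x y = (Real.Gamma (besselIndex N a 0 + 1) : ℂ) *
      ∑' m : ℕ, kernelPhase a m * (zonalBessel a a (-1) m x y : ℂ) := by
  have hr : 0 ≤ ‖x‖ * ‖y‖ := by positivity
  set r := ‖x‖ * ‖y‖
  have hw : 2 * ((r ^ (a / 2) : ℝ) : ℂ) / ((a : ℂ) * Complex.I) / 2 =
      ((r ^ (a / 2) / a : ℝ) : ℂ) * -Complex.I := by
    have : (a : ℂ) ≠ 0 := by exact_mod_cast ha.ne'
    push_cast
    field_simp
    rw [Complex.I_sq]
    ring
  have hindex : ∀ m : ℕ, 2 / a * ((m : ℝ) + ((N : ℝ) - 2) / 2) = besselIndex N a m := by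
    intro m
    rw [besselIndex]
    field_simp
    ring
  have hsq : (r ^ (a / 2) / a) ^ 2 = r ^ a / a ^ 2 := by
    rw [div_pow, ← Real.rpow_natCast (r ^ (a / 2)), ← Real.rpow_mul hr]
    congr 2
    push_cast
    ring
  rw [fourierKernel, scriptI]
  congr 1
  · rw [← hindex 0]
    simp
  refine tsum_congr fun m => ?_
  have hB : normalizedBesselI (2 / a * ((m : ℝ) + ((N : ℝ) - 2) / 2))
      (2 * ((r ^ (a / 2) : ℝ) : ℂ) / ((a : ℂ) * Complex.I)) =
      (besselSeries (besselIndex N a m) (-1 * r ^ a / a ^ 2) : ℂ) := by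
    rw [normalizedBesselI, besselSeries, Complex.ofReal_tsum, hindex]
    refine tsum_congr fun k => ?_
    rw [hw, pow_mul, mul_pow, neg_sq, Complex.I_sq, ← Complex.ofReal_pow, hsq]
    push_cast
    ring
  -- A positive factor does not move the principal argument of -i, so the principal power splits
  -- into a real power and a phase. For r = 0 only m = 0 survives, through 0 ^ 0 = 1.
  have hP : (((r ^ (a / 2) / a : ℝ) : ℂ) * -Complex.I) ^ ((2 / a * m : ℝ) : ℂ) =
      kernelPhase a m * ((a ^ (-(2 / a * m)) * r ^ m : ℝ) : ℂ) := by
    rcases hr.eq_or_lt with h0 | h0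
    · rw [← h0, Real.zero_rpow (by positivity)]
      rcases Nat.eq_zero_or_pos m with rfl | hm
      · simp [kernelPhase]
      · have h1 : ((2 / a * m : ℝ) : ℂ) ≠ 0 := by
          have : 0 < 2 / a * m := by positivity
          exact_mod_cast this.ne'
        rw [zero_div, Complex.ofReal_zero, zero_mul, Complex.zero_cpow h1, zero_pow hm.ne']
        simp
    · have hρ : 0 < r ^ (a / 2) / a := by positivity
      have hρ' : ((r ^ (a / 2) / a : ℝ) : ℂ) ≠ 0 := by exact_mod_cast hρ.ne'
      have h1 : a ^ (-(2 / a * m)) * r ^ m = (r ^ (a / 2) / a) ^ (2 / a * m) := by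
        rw [Real.div_rpow (by positivity) ha.le, ← Real.rpow_mul hr,
          show a / 2 * (2 / a * m) = m by field_simp, Real.rpow_natCast, Real.rpow_neg ha.le]
        ring
      rw [h1, Complex.ofReal_cpow hρ.le, kernelPhase,
        Complex.cpow_def_of_ne_zero (mul_ne_zero hρ' (by simp)),
        Complex.cpow_def_of_ne_zero (by simp), Complex.cpow_def_of_ne_zero hρ',
        Complex.log_ofReal_mul hρ (by simp), ← Complex.exp_add, Complex.ofReal_log hρ.le]
      ring_nf
  rw [hB, hw, hP, zonalBessel, zonal_eq_normalizedGegenbauer,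
    show ‖x‖ * ‖y‖ = r from rfl]
  push_cast
  ring

end DeformedHeat

/-! ### The closed series for the heat kernel. -/

namespace DeformedHeat

open MeasureTheory Filter Topology

variable {N : ℕ} {a : ℝ}

theorem summable_zonalBessel (ha : 0 < a) (haN : 2 - (N : ℝ) < a) {A e : ℝ} (hA : 0 < A)
    (he : |e| = 1) (x y : EuclideanSpace ℝ (Fin N)) :
    Summable fun m => |zonalBessel a A e m x y| := by
  obtain ⟨K, -, hK⟩ := exists_abs_zonalBessel_le ha haN hA he one_pos x
  exact Summable.of_nonneg_of_le (fun _ => abs_nonneg _) (fun m => hK m y)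
    ((summable_geometric_two.mul_left K).mul_right _)

theorem sphereIntegral_one_pos (hN : 1 ≤ N) :
    0 < sphereIntegral (1 : MvPolynomial (Fin N) ℝ) := by
  have := nontrivial_euclideanSpace hN
  simp only [sphereIntegral, map_one, integral_const, smul_eq_mul, mul_one]
  have h : (volume : Measure (EuclideanSpace ℝ (Fin N))).toSphere ≠ 0 :=
    Measure.toSphere_ne_zero _
  have : NeZero (volume : Measure (EuclideanSpace ℝ (Fin N))).toSphere := ⟨h⟩
  exact measureReal_univ_pos

/-- The polar Jacobian, two harmonics of degree m and the weight |z|^(a-2) combine to exactly the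
exponent in the Bessel integrals of order l_m. -/
theorem rpow_mul_natPow_eq (hN : 1 ≤ N) (ha : 0 < a) {s : ℝ} (hs : 0 < s) (m k : ℕ) :
    s ^ (N - 1 + 2 * m) * (s ^ ((k : ℝ) * a) * s ^ (a - 2)) =
      s ^ (a * (besselIndex N a m + k + 1) - 1) := by
  rw [← Real.rpow_natCast, ← Real.rpow_add hs, ← Real.rpow_add hs]
  congr 1
  push_cast [Nat.cast_sub hN]
  rw [besselIndex]
  field_simp
  ring

theorem normConst_mul (hN : 1 ≤ N) (ha : 0 < a) (haN : 2 - (N : ℝ) < a) :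
    normConst N a * (Real.Gamma (besselIndex N a 0 + 1) *
      sphereIntegral (1 : MvPolynomial (Fin N) ℝ) *
      (1 / a * a ^ (besselIndex N a 0 + 1))) = 1 := by
  have hl := neg_one_lt_besselIndex (N := N) ha haN 0
  have h := integral_radial_mul_eval hN (MvPolynomial.isHomogeneous_one (Fin N) ℝ)
    (fun s => Real.exp (-(1 / a) * s ^ a) * s ^ (a - 2))
  simp only [map_one, mul_one, add_zero] at h
  have h1 : ∫ s in Set.Ioi (0 : ℝ), s ^ (N - 1) * (Real.exp (-(1 / a) * s ^ a) * s ^ (a - 2)) =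
      1 / a * a ^ (besselIndex N a 0 + 1) * Real.Gamma (besselIndex N a 0 + 1) := by
    have h2 := integral_rpow_mul_exp ha hl (one_div_pos.2 ha) 0
    have h3 : (1 / a) ^ (-(besselIndex N a 0 + 1)) = a ^ (besselIndex N a 0 + 1) := by
      rw [Real.rpow_neg (by positivity), Real.div_rpow one_pos.le ha.le, Real.one_rpow, one_div,
        inv_inv]
    rw [h3, pow_zero, mul_one, Nat.cast_zero, add_zero] at h2
    rw [← h2]
    refine setIntegral_congr_fun measurableSet_Ioi fun s hs => ?_
    have h4 := rpow_mul_natPow_eq hN ha hs 0 0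
    simp only [Nat.cast_zero, zero_mul, Real.rpow_zero, one_mul, mul_zero, add_zero] at h4
    rw [← h4]
    ring
  have hG := Real.Gamma_pos_of_pos (by linarith : 0 < besselIndex N a 0 + 1)
  have hS := sphereIntegral_one_pos hN
  rw [normConst, h, h1]
  field_simp

/-- Weber's integral for the summands of the Fourier kernel. -/
theorem integral_zonalBessel_mul_zonalBessel (hN : 1 ≤ N) (ha : 0 < a) (haN : 2 - (N : ℝ) < a)
    {t : ℝ} (ht : 0 < t) (x y : EuclideanSpace ℝ (Fin N)) (m n : ℕ) :
    ∫ z : EuclideanSpace ℝ (Fin N), zonalBessel a a (-1) m x z * zonalBessel a a (-1) n y z *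
      (Real.exp (-(t / a) * ‖z‖ ^ a) * ‖z‖ ^ (a - 2)) =
      if m = n then sphereIntegral (1 : MvPolynomial (Fin N) ℝ) *
        (1 / a * (t / a) ^ (-(besselIndex N a 0 + 1)) *
          Real.exp (-(‖x‖ ^ a + ‖y‖ ^ a) / (a * t))) * zonalBessel a (a * t) 1 m x y else 0 := by
  have h := integral_radial_mul_zonal_mul_zonal hN x y m n (fun s =>
    a ^ (-(2 / a * m)) * a ^ (-(2 / a * n)) *
      besselSeries (besselIndex N a m) (-1 * (‖x‖ * s) ^ a / a ^ 2) *
      besselSeries (besselIndex N a n) (-1 * (‖y‖ * s) ^ a / a ^ 2) *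
      (Real.exp (-(t / a) * s ^ a) * s ^ (a - 2)))
  have h0 : ∀ z : EuclideanSpace ℝ (Fin N),
      zonalBessel a a (-1) m x z * zonalBessel a a (-1) n y z *
        (Real.exp (-(t / a) * ‖z‖ ^ a) * ‖z‖ ^ (a - 2)) =
      a ^ (-(2 / a * m)) * a ^ (-(2 / a * n)) *
      besselSeries (besselIndex N a m) (-1 * (‖x‖ * ‖z‖) ^ a / a ^ 2) *
      besselSeries (besselIndex N a n) (-1 * (‖y‖ * ‖z‖) ^ a / a ^ 2) *
      (Real.exp (-(t / a) * ‖z‖ ^ a) * ‖z‖ ^ (a - 2)) * (zonal m x z * zonal n y z) := by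
    intro z
    simp only [zonalBessel]
    ring
  simp only [h0]
  rw [h]
  split_ifs with hmn
  swap
  · rfl
  subst hmn
  have hl := neg_one_lt_besselIndex (N := N) ha haN m
  have hW := integral_besselSeries_mul_besselSeries ha hl (div_pos ht ha) (-1 * ‖x‖ ^ a / a ^ 2)
    (-1 * ‖y‖ ^ a / a ^ 2)
  have h1 : ∫ s in Set.Ioi (0 : ℝ), s ^ (N - 1 + 2 * m) * (a ^ (-(2 / a * m)) *
      a ^ (-(2 / a * m)) * besselSeries (besselIndex N a m) (-1 * (‖x‖ * s) ^ a / a ^ 2) *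
      besselSeries (besselIndex N a m) (-1 * (‖y‖ * s) ^ a / a ^ 2) *
      (Real.exp (-(t / a) * s ^ a) * s ^ (a - 2))) =
      a ^ (-(2 / a * m)) * a ^ (-(2 / a * m)) * ∫ s in Set.Ioi (0 : ℝ),
        s ^ (a * (besselIndex N a m + 1) - 1) *
        besselSeries (besselIndex N a m) (-1 * ‖x‖ ^ a / a ^ 2 * s ^ a) *
        besselSeries (besselIndex N a m) (-1 * ‖y‖ ^ a / a ^ 2 * s ^ a) *
        Real.exp (-(t / a) * s ^ a) := by
    rw [← integral_const_mul]
    refine setIntegral_congr_fun measurableSet_Ioi fun s hs => ?_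
    have hs0 : 0 ≤ s := le_of_lt hs
    have h2 := rpow_mul_natPow_eq hN ha hs m 0
    simp only [Nat.cast_zero, zero_mul, Real.rpow_zero, one_mul, add_zero] at h2
    have h3 : ∀ r : ℝ, 0 ≤ r → -1 * (r * s) ^ a / a ^ 2 = -1 * r ^ a / a ^ 2 * s ^ a := by
      intro r hr
      rw [Real.mul_rpow hr hs0]
      ring
    rw [h3 _ (norm_nonneg _), h3 _ (norm_nonneg _), ← h2]
    ring
  have h4 : -1 * ‖x‖ ^ a / a ^ 2 * (-1 * ‖y‖ ^ a / a ^ 2) / (t / a) ^ 2 =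
      1 * (‖x‖ * ‖y‖) ^ a / (a * t) ^ 2 := by
    rw [Real.mul_rpow (norm_nonneg _) (norm_nonneg _)]
    field_simp
  have h5 : (-1 * ‖x‖ ^ a / a ^ 2 + -1 * ‖y‖ ^ a / a ^ 2) / (t / a) =
      -(‖x‖ ^ a + ‖y‖ ^ a) / (a * t) := by
    field_simp
    ring
  -- The two normalizations combine with the m-dependent part of Weber's power of t/a to give the
  -- scale at of the heat series.
  have h6 : a ^ (-(2 / a * m)) * a ^ (-(2 / a * m)) * (t / a) ^ (-(besselIndex N a m + 1)) =
      (t / a) ^ (-(besselIndex N a 0 + 1)) * (a * t) ^ (-(2 / a * m)) := by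
    rw [besselIndex_eq N a m, show -(besselIndex N a 0 + 2 / a * m + 1) =
      -(besselIndex N a 0 + 1) + -(2 / a * m) by ring, Real.rpow_add (div_pos ht ha),
      Real.mul_rpow ha.le ht.le, Real.div_rpow ht.le ha.le _]
    have := (Real.rpow_pos_of_pos ha (-(2 / a * m))).ne'
    rw [Real.div_rpow ht.le ha.le (-(2 / a * m))]
    field_simp
  rw [h1, hW, h4, h5, zonalBessel]
  linear_combination (zonal m x y * sphereIntegral (1 : MvPolynomial (Fin N) ℝ) * (1 / a) *
    Real.exp (-(‖x‖ ^ a + ‖y‖ ^ a) / (a * t)) *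
    besselSeries (besselIndex N a m) (1 * (‖x‖ * ‖y‖) ^ a / (a * t) ^ 2)) * h6

theorem heatKernel_eq (hN : 1 ≤ N) (ha : 0 < a) (haN : 2 - (N : ℝ) < a)
    {t : ℝ} (ht : 0 < t) (x y : EuclideanSpace ℝ (Fin N)) :
    heatKernel a x y t = ((Real.Gamma (besselIndex N a 0 + 1) * t ^ (-(besselIndex N a 0 + 1)) *
      Real.exp (-(‖x‖ ^ a + ‖y‖ ^ a) / (a * t)) * ∑' m : ℕ, zonalBessel a (a * t) 1 m x y : ℝ) :
        ℂ) := by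
  set G := Real.Gamma (besselIndex N a 0 + 1)
  set S := sphereIntegral (1 : MvPolynomial (Fin N) ℝ)
  set w : EuclideanSpace ℝ (Fin N) → ℝ := fun z =>
    Real.exp (-(t / a) * ‖z‖ ^ a) * ‖z‖ ^ (a - 2)
  set R : ℕ × ℕ → EuclideanSpace ℝ (Fin N) → ℝ := fun p z =>
    zonalBessel a a (-1) p.1 x z * zonalBessel a a (-1) p.2 y z * w z
  set F : ℕ × ℕ → EuclideanSpace ℝ (Fin N) → ℂ := fun p z =>
    (G ^ 2 * (conj (kernelPhase a p.1) * kernelPhase a p.2)) * (R p z : ℂ)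
  have he : |(-1 : ℝ)| = 1 := by simp
  -- Each of the two kernels may grow at rate t/(4a), which leaves half of the decay rate t/a for
  -- the dominating function `D`.
  have htd : 0 < t / (4 * a) := by positivity
  obtain ⟨K, hK0, hK⟩ := exists_abs_zonalBessel_le ha haN ha he htd x
  obtain ⟨L, hL0, hL⟩ := exists_abs_zonalBessel_le ha haN ha he htd y
  set D : EuclideanSpace ℝ (Fin N) → ℝ := fun z =>
    Real.exp (-(t / (2 * a)) * ‖z‖ ^ a) * (‖z‖ ^ (0 : ℝ) * ‖z‖ ^ (a - 2))
  have hD : Integrable D := integrable_norm_rpow_mul_rpow_mul_exp hN ha (by positivity)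
    (by linarith)
  have hRD : ∀ p z, ‖R p z‖ ≤ K * L * ((1 / 2) ^ p.1 * (1 / 2) ^ p.2) * D z := by
    intro p z
    have hw : 0 ≤ w z := by positivity
    simp only [R, norm_mul, Real.norm_eq_abs, abs_of_nonneg hw]
    calc _ ≤ (K * (1 / 2) ^ p.1 * Real.exp (t / (4 * a) * ‖z‖ ^ a)) *
          (L * (1 / 2) ^ p.2 * Real.exp (t / (4 * a) * ‖z‖ ^ a)) * w z := by
          gcongr
          exacts [hK _ _, hL _ _]
      _ = K * L * ((1 / 2) ^ p.1 * (1 / 2) ^ p.2) * (Real.exp (t / (4 * a) * ‖z‖ ^ a) *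
          Real.exp (t / (4 * a) * ‖z‖ ^ a) * Real.exp (-(t / a) * ‖z‖ ^ a)) * ‖z‖ ^ (a - 2) := by
          simp only [w]
          ring
      _ = _ := by
          simp only [D]
          rw [← Real.exp_add, ← Real.exp_add, Real.rpow_zero, one_mul, mul_assoc]
          congr 3
          field_simp
          ring
  have hRm : ∀ p, AEStronglyMeasurable (R p) := by
    intro p
    have h1 := measurable_zonalBessel ha haN a (-1) p.1 x
    have h2 := measurable_zonalBessel ha haN a (-1) p.2 y
    exact ((h1.mul h2).mul (by fun_prop)).aestronglyMeasurable
  have hR : ∀ p, Integrable (R p) := fun p =>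
    (hD.const_mul _).mono' (hRm p) (ae_of_all _ (hRD p))
  have hF : ∀ p, Integrable (F p) := fun p => (hR p).ofReal.const_mul _
  have hFn : ∀ p z, ‖F p z‖ = G ^ 2 * ‖R p z‖ := by
    intro p z
    simp only [F, norm_mul, norm_pow, RCLike.norm_conj, norm_kernelPhase, Complex.norm_real,
      mul_one, Real.norm_eq_abs, sq_abs]
  have hsum : Summable fun p => ∫ z, ‖F p z‖ := by
    have hgeo := Summable.mul_of_nonneg summable_geometric_two summable_geometric_two
      (fun n => by positivity) (fun n => by positivity)
    refine Summable.of_nonneg_of_le (fun p => integral_nonneg fun z => norm_nonneg _) (fun p => ?_)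
      ((hgeo.mul_left (G ^ 2 * (K * L))).mul_right (∫ z, D z))
    simp only [hFn]
    rw [integral_const_mul]
    calc G ^ 2 * ∫ z, ‖R p z‖ ≤ G ^ 2 * ∫ z, K * L * ((1 / 2) ^ p.1 * (1 / 2) ^ p.2) * D z := by
          gcongr
          · exact (hR p).norm
          · exact hD.const_mul _
          · exact fun z => hRD p z
      _ = _ := by
          rw [integral_const_mul]
          ring
  have hmain := (hasSum_integral_of_summable_integral_norm hF hsum).tsum_eq
  have hintF : ∀ p : ℕ × ℕ, ∫ z, F p z = if p.1 = p.2 then ((G ^ 2 * (S *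
      (1 / a * (t / a) ^ (-(besselIndex N a 0 + 1)) *
        Real.exp (-(‖x‖ ^ a + ‖y‖ ^ a) / (a * t))) * zonalBessel a (a * t) 1 p.1 x y) : ℝ) : ℂ)
      else 0 := by
    intro p
    simp only [F]
    rw [integral_const_mul, integral_complex_ofReal]
    simp only [R, w]
    rw [integral_zonalBessel_mul_zonalBessel hN ha haN ht]
    split_ifs with hp
    -- On the diagonal a phase meets its own conjugate.
    · rw [← hp, Complex.conj_mul', norm_kernelPhase]
      push_cast
      ring
    · simp
  have hdiag : ∑' p : ℕ × ℕ, ∫ z, F p z = ∑' m : ℕ, ((G ^ 2 * (S *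
      (1 / a * (t / a) ^ (-(besselIndex N a 0 + 1)) *
        Real.exp (-(‖x‖ ^ a + ‖y‖ ^ a) / (a * t))) * zonalBessel a (a * t) 1 m x y) : ℝ) : ℂ) := by
    have hinj : Function.Injective fun m : ℕ => (m, m) := fun m n h => (Prod.ext_iff.1 h).1
    rw [← hinj.tsum_eq]
    · exact tsum_congr fun m => by rw [hintF, if_pos rfl]
    · rintro ⟨m, n⟩ hp
      rw [Function.mem_support, hintF] at hp
      have : m = n := by
        by_contra h
        exact hp (if_neg h)
      exact ⟨m, by rw [this]⟩
  have hprod : ∀ z, conj (fourierKernel a x z) * fourierKernel a y z * ((w z : ℝ) : ℂ) =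
      ∑' p : ℕ × ℕ, F p z := by
    intro z
    have hs : ∀ v : EuclideanSpace ℝ (Fin N), Summable fun m : ℕ =>
        ‖kernelPhase a m * (zonalBessel a a (-1) m v z : ℂ)‖ := by
      intro v
      simp only [norm_mul, norm_kernelPhase, one_mul, Complex.norm_real]
      exact summable_zonalBessel ha haN ha he v z
    have hs' : Summable fun m : ℕ =>
        ‖conj (kernelPhase a m * (zonalBessel a a (-1) m x z : ℂ))‖ := by
      simpa only [RCLike.norm_conj] using hs x
    rw [fourierKernel_eq_tsum ha, fourierKernel_eq_tsum ha, map_mul, Complex.conj_ofReal,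
      Complex.conj_tsum, mul_mul_mul_comm, tsum_mul_tsum_of_summable_norm hs' (hs y),
      ← tsum_mul_left, ← tsum_mul_right]
    refine tsum_congr fun p => ?_
    simp only [F, R, map_mul, Complex.conj_ofReal]
    push_cast
    ring
  have hc := normConst_mul hN ha haN
  have hta : (t / a) ^ (-(besselIndex N a 0 + 1)) =
      t ^ (-(besselIndex N a 0 + 1)) * a ^ (besselIndex N a 0 + 1) := by
    rw [Real.div_rpow ht.le ha.le, Real.rpow_neg ha.le, div_inv_eq_mul]
  have hint : ∫ z, conj (fourierKernel a x z) * fourierKernel a y z * ((w z : ℝ) : ℂ) =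
      ∑' p : ℕ × ℕ, ∫ z, F p z := by
    simp only [hprod]
    exact hmain.symm
  rw [heatKernel, hint, hdiag, ← Complex.ofReal_tsum, ← Complex.ofReal_mul, tsum_mul_left,
    tsum_mul_left, hta]
  congr 1
  linear_combination (G * t ^ (-(besselIndex N a 0 + 1)) *
    Real.exp (-(‖x‖ ^ a + ‖y‖ ^ a) / (a * t)) * ∑' m : ℕ, zonalBessel a (a * t) 1 m x y) * hc

end DeformedHeat

/-! ### Radial moments and the polynomials that express them. -/

namespace DeformedHeat

open MeasureTheory Filter Topology

variable {N : ℕ} {a : ℝ}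

/-- The radial moments of the heat kernel. -/
theorem integral_heatKernel_mul_rpow (hN : 1 ≤ N) (ha : 0 < a) (haN : 2 - (N : ℝ) < a)
    {t : ℝ} (ht : 0 < t) (x : EuclideanSpace ℝ (Fin N)) (M : ℕ) :
    Integrable (fun y : EuclideanSpace ℝ (Fin N) =>
      heatKernel a x y t * ((‖y‖ ^ ((M : ℝ) * a) * ‖y‖ ^ (a - 2) : ℝ) : ℂ)) ∧
    (normConst N a : ℂ) * ∫ y : EuclideanSpace ℝ (Fin N),
      heatKernel a x y t * ((‖y‖ ^ ((M : ℝ) * a) * ‖y‖ ^ (a - 2) : ℝ) : ℂ) =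
      (((a * t) ^ M * laguerreSum (besselIndex N a 0) M (‖x‖ ^ a / (a * t)) : ℝ) : ℂ) := by
  have hat : 0 < a * t := mul_pos ha ht
  have hl := neg_one_lt_besselIndex (N := N) ha haN 0
  set l := besselIndex N a 0
  set S := sphereIntegral (1 : MvPolynomial (Fin N) ℝ)
  set w : EuclideanSpace ℝ (Fin N) → ℝ := fun y =>
    Real.exp (-(1 / (a * t)) * ‖y‖ ^ a) * (‖y‖ ^ ((M : ℝ) * a) * ‖y‖ ^ (a - 2))
  set H : ℕ → EuclideanSpace ℝ (Fin N) → ℝ := fun m y => zonalBessel a (a * t) 1 m x y * w y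
  set κ : ℝ := Real.Gamma (l + 1) * t ^ (-(l + 1)) * Real.exp (-‖x‖ ^ a / (a * t))
  have he : |(1 : ℝ)| = 1 := abs_one
  have hd : 0 < 1 / (2 * (a * t)) := by positivity
  obtain ⟨K, hK0, hK⟩ := exists_abs_zonalBessel_le ha haN hat he hd x
  set D : EuclideanSpace ℝ (Fin N) → ℝ := fun y =>
    Real.exp (-(1 / (2 * (a * t))) * ‖y‖ ^ a) * (‖y‖ ^ ((M : ℝ) * a) * ‖y‖ ^ (a - 2))
  have hMa : 0 ≤ (M : ℝ) * a := by positivity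
  have hD : Integrable D := integrable_norm_rpow_mul_rpow_mul_exp hN ha hd (by linarith)
  have hHD : ∀ m y, ‖H m y‖ ≤ K * (1 / 2) ^ m * D y := by
    intro m y
    have hw : 0 ≤ w y := by positivity
    simp only [H, norm_mul, Real.norm_eq_abs, abs_of_nonneg hw]
    calc _ ≤ K * (1 / 2) ^ m * Real.exp (1 / (2 * (a * t)) * ‖y‖ ^ a) * w y := by
          gcongr
          exact hK _ _
      _ = K * (1 / 2) ^ m * (Real.exp (1 / (2 * (a * t)) * ‖y‖ ^ a) *
          Real.exp (-(1 / (a * t)) * ‖y‖ ^ a)) * (‖y‖ ^ ((M : ℝ) * a) * ‖y‖ ^ (a - 2)) := by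
          simp only [w]
          ring
      _ = _ := by
          simp only [D]
          rw [← Real.exp_add, mul_assoc]
          congr 3
          field_simp
          ring
  have hHm : ∀ m, Measurable (H m) := fun m =>
    (measurable_zonalBessel ha haN (a * t) 1 m x).mul (by fun_prop)
  have hHi : ∀ m, Integrable (H m) := fun m =>
    (hD.const_mul _).mono' (hHm m).aestronglyMeasurable (ae_of_all _ (hHD m))
  have hsum : Summable fun m => ∫ y, ‖H m y‖ := by
    refine Summable.of_nonneg_of_le (fun p => integral_nonneg fun z => norm_nonneg _) (fun m => ?_)
      ((summable_geometric_two.mul_left K).mul_right (∫ y, D y))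
    rw [← integral_const_mul]
    exact integral_mono (hHi m).norm (hD.const_mul _) (hHD m)
  have hHs : ∀ y, HasSum (fun m => H m y) (∑' m, H m y) := fun y =>
    (Summable.of_norm_bounded ((summable_geometric_two.mul_left K).mul_right (D y))
      fun m => hHD m y).hasSum
  have hmeas : Measurable fun y => ∑' m, H m y :=
    measurable_of_tendsto_metrizable (fun n => Finset.measurable_sum (Finset.range n)
      fun m _ => hHm m) (tendsto_pi_nhds.2 fun y => by
        simpa only [Finset.sum_apply] using (hHs y).tendsto_sum_nat)
  have hint : Integrable fun y => ∑' m, H m y := by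
    refine (hD.const_mul (K * 2)).mono' hmeas.aestronglyMeasurable (ae_of_all _ fun y => ?_)
    exact tsum_of_norm_bounded ((hasSum_geometric_two.mul_left K).mul_right (D y))
      fun m => hHD m y
  have hfun : ∀ y, heatKernel a x y t * ((‖y‖ ^ ((M : ℝ) * a) * ‖y‖ ^ (a - 2) : ℝ) : ℂ) =
      ((κ * ∑' m, H m y : ℝ) : ℂ) := by
    intro y
    have h1 : Real.exp (-(‖x‖ ^ a + ‖y‖ ^ a) / (a * t)) =
        Real.exp (-‖x‖ ^ a / (a * t)) * Real.exp (-(1 / (a * t)) * ‖y‖ ^ a) := by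
      rw [← Real.exp_add]
      ring_nf
    rw [heatKernel_eq hN ha haN ht, ← Complex.ofReal_mul, tsum_mul_right, h1]
    congr 1
    simp only [w, κ]
    ring
  have hH0 : ∀ m, ∫ y, H m y = if m = 0 then S * (1 / a * (a * t) ^ (l + 1) * (a * t) ^ M *
      (laguerreSum l M (‖x‖ ^ a / (a * t)) * Real.exp (‖x‖ ^ a / (a * t)))) else 0 := by
    intro m
    -- The constant harmonic of degree 0 is inserted as a second factor, so orthogonality kills
    -- every m other than 0.
    have h := integral_radial_mul_zonal_mul_zonal hN x x m 0 (fun s =>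
      (a * t) ^ (-(2 / a * m)) * besselSeries (besselIndex N a m)
        (1 * (‖x‖ * s) ^ a / (a * t) ^ 2) *
        (Real.exp (-(1 / (a * t)) * s ^ a) * (s ^ ((M : ℝ) * a) * s ^ (a - 2))))
    have h0 : ∀ y, H m y = (a * t) ^ (-(2 / a * m)) * besselSeries (besselIndex N a m)
        (1 * (‖x‖ * ‖y‖) ^ a / (a * t) ^ 2) * (Real.exp (-(1 / (a * t)) * ‖y‖ ^ a) *
          (‖y‖ ^ ((M : ℝ) * a) * ‖y‖ ^ (a - 2))) * (zonal m x y * zonal 0 x y) := by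
      intro y
      simp only [H, w, zonalBessel, zonal_zero]
      ring
    simp only [h0]
    rw [h]
    split_ifs with hm
    swap
    · rfl
    subst hm
    have h1 := integral_rpow_mul_besselSeries ha hl (one_div_pos.2 hat)
      (‖x‖ ^ a / (a * t) ^ 2) M
    have h2 : (1 / (a * t)) ^ (-(l + 1)) = (a * t) ^ (l + 1) := by
      rw [Real.rpow_neg (by positivity), Real.div_rpow one_pos.le hat.le, Real.one_rpow, one_div,
        inv_inv]
    have h3 : ‖x‖ ^ a / (a * t) ^ 2 / (1 / (a * t)) = ‖x‖ ^ a / (a * t) := by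
      field_simp
    rw [h2, h3, one_div_one_div] at h1
    rw [zonal_zero, one_mul, ← h1]
    congr 1
    refine setIntegral_congr_fun measurableSet_Ioi fun s hs => ?_
    have hs0 : 0 ≤ s := le_of_lt hs
    have h4 := rpow_mul_natPow_eq hN ha hs 0 M
    rw [mul_zero, add_zero] at h4 ⊢
    rw [← h4, Real.mul_rpow (norm_nonneg _) hs0]
    simp only [Nat.cast_zero, mul_zero, neg_zero, Real.rpow_zero, one_mul]
    rw [mul_div_right_comm]
    ring
  have hI : ∫ y, ∑' m, H m y = S * (1 / a * (a * t) ^ (l + 1) * (a * t) ^ M *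
      (laguerreSum l M (‖x‖ ^ a / (a * t)) * Real.exp (‖x‖ ^ a / (a * t)))) := by
    rw [← (hasSum_integral_of_summable_integral_norm hHi hsum).tsum_eq]
    simp only [hH0]
    exact tsum_ite_eq _ _
  simp only [hfun]
  refine ⟨(hint.const_mul κ).ofReal, ?_⟩
  rw [integral_complex_ofReal, ← Complex.ofReal_mul, integral_const_mul, hI]
  congr 1
  have hc := normConst_mul hN ha haN
  -- The exponential produced by the Bessel moment cancels the Gaussian prefactor in x, so a
  -- polynomial remains.
  have h5 : Real.exp (-‖x‖ ^ a / (a * t)) * Real.exp (‖x‖ ^ a / (a * t)) = 1 := by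
    rw [← Real.exp_add, neg_div, neg_add_cancel, Real.exp_zero]
  have h6 : t ^ (-(l + 1)) * (a * t) ^ (l + 1) = a ^ (l + 1) := by
    rw [Real.mul_rpow ha.le ht.le, mul_left_comm, ← Real.rpow_add ht, neg_add_cancel,
      Real.rpow_zero, mul_one]
  calc normConst N a * (κ * (S * (1 / a * (a * t) ^ (l + 1) * (a * t) ^ M *
        (laguerreSum l M (‖x‖ ^ a / (a * t)) * Real.exp (‖x‖ ^ a / (a * t))))))
      = normConst N a * (Real.Gamma (l + 1) * S *
        (1 / a * (t ^ (-(l + 1)) * (a * t) ^ (l + 1)))) *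
        (Real.exp (-‖x‖ ^ a / (a * t)) * Real.exp (‖x‖ ^ a / (a * t))) *
        ((a * t) ^ M * laguerreSum l M (‖x‖ ^ a / (a * t))) := by
        simp only [κ]
        ring
    _ = _ := by rw [h6, hc, h5, one_mul, one_mul]

/-- The homogeneous polynomial of degree `M` giving the radial moment of order `M` of the heat
kernel. -/
noncomputable def momentPoly (l a : ℝ) (M : ℕ) : MvPolynomial (Fin 2) ℝ :=
  ∑ i ∈ Finset.range (M + 1), MvPolynomial.C (a ^ (M - i) *
    ((M.choose i : ℝ) * Real.Gamma (l + M + 1) / Real.Gamma (l + i + 1))) *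
      (MvPolynomial.X 0 ^ (M - i) * MvPolynomial.X 1 ^ i)

theorem isHomogeneous_momentPoly (l a : ℝ) (M : ℕ) : (momentPoly l a M).IsHomogeneous M := by
  refine MvPolynomial.IsHomogeneous.sum _ _ _ fun i hi => ?_
  have h := (MvPolynomial.isHomogeneous_X_pow (R := ℝ) (0 : Fin 2) (M - i)).mul
    (MvPolynomial.isHomogeneous_X_pow (R := ℝ) (1 : Fin 2) i)
  rw [Nat.sub_add_cancel (Nat.lt_succ_iff.1 (Finset.mem_range.1 hi))] at h
  exact h.C_mul _

theorem eval_momentPoly (l a T Z : ℝ) (M : ℕ) : MvPolynomial.eval ![T, Z] (momentPoly l a M) =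
    ∑ i ∈ Finset.range (M + 1), a ^ (M - i) *
      ((M.choose i : ℝ) * Real.Gamma (l + M + 1) / Real.Gamma (l + i + 1)) *
        (T ^ (M - i) * Z ^ i) := by
  simp [momentPoly, map_sum]

theorem eval_momentPoly_eq_laguerreSum {t : ℝ} (hat : a * t ≠ 0) (l Z : ℝ) (M : ℕ) :
    MvPolynomial.eval ![t, Z] (momentPoly l a M) = (a * t) ^ M * laguerreSum l M (Z / (a * t)) := by
  rw [eval_momentPoly, laguerreSum, Finset.mul_sum]
  refine Finset.sum_congr rfl fun i hi => ?_
  have h : (a * t) ^ M = (a * t) ^ (M - i) * (a * t) ^ i := by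
    rw [← pow_add, Nat.sub_add_cancel (Nat.lt_succ_iff.1 (Finset.mem_range.1 hi))]
  rw [h, div_pow, mul_pow a t (M - i)]
  field_simp

theorem momentPoly_ne_zero {l : ℝ} (hl : -1 < l) (a : ℝ) (M : ℕ) : momentPoly l a M ≠ 0 := by
  intro h
  -- At (0, 1) only the top term i = M survives, and its value is 1.
  have h1 := eval_momentPoly l a 0 1 M
  rw [h, map_zero, Finset.sum_range_succ, Finset.sum_eq_zero] at h1
  · have := (Gamma_add_nat_pos hl M).ne'
    simp [this] at h1
  · intro i hi
    rw [zero_pow (by simp at hi; omega), zero_mul, mul_zero]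

theorem momentPoly_zero {l : ℝ} (hl : -1 < l) (a : ℝ) : momentPoly l a 0 = 1 := by
  have := (Real.Gamma_pos_of_pos (by linarith : 0 < l + 1)).ne'
  simp [momentPoly, this]

end DeformedHeat

theorem corollary4p7 (N : ℕ) (hN : 1 ≤ N) (a : ℝ) (ha : max 0 (2 - (N : ℝ)) < a) :
    (∀ (x : EuclideanSpace ℝ (Fin N)) (t : ℝ), 0 < t →
      MeasureTheory.Integrable (fun y : EuclideanSpace ℝ (Fin N) =>
          DeformedHeat.heatKernel a x y t * ((‖y‖ ^ (a - 2) : ℝ) : ℂ)) ∧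
      (DeformedHeat.normConst N a : ℂ) *
        ∫ y : EuclideanSpace ℝ (Fin N),
          DeformedHeat.heatKernel a x y t * ((‖y‖ ^ (a - 2) : ℝ) : ℂ) = 1) ∧
    (∀ m : ℕ, ∃ f : MvPolynomial (Fin 2) ℝ, f.IsHomogeneous m ∧ f ≠ 0 ∧
      ∀ (x : EuclideanSpace ℝ (Fin N)) (t : ℝ), 0 < t →
        MeasureTheory.Integrable (fun y : EuclideanSpace ℝ (Fin N) =>
          DeformedHeat.heatKernel a x y t *
            ((‖y‖ ^ ((m : ℝ) * a) * ‖y‖ ^ (a - 2) : ℝ) : ℂ)) ∧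
        (DeformedHeat.normConst N a : ℂ) *
          ∫ y : EuclideanSpace ℝ (Fin N),
            DeformedHeat.heatKernel a x y t *
              ((‖y‖ ^ ((m : ℝ) * a) * ‖y‖ ^ (a - 2) : ℝ) : ℂ) =
          ((MvPolynomial.eval ![t, ‖x‖ ^ a] f : ℝ) : ℂ)) := by
  obtain ⟨ha0, haN⟩ := max_lt_iff.1 ha
  have hl := DeformedHeat.neg_one_lt_besselIndex (N := N) ha0 haN 0
  refine ⟨fun x t ht => ?_, fun m => ⟨DeformedHeat.momentPoly (DeformedHeat.besselIndex N a 0) a m,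
    DeformedHeat.isHomogeneous_momentPoly _ _ _, DeformedHeat.momentPoly_ne_zero hl _ _,
    fun x t ht => ?_⟩⟩
  -- The total mass is the moment of order 0, whose polynomial is 1.
  · have h := DeformedHeat.integral_heatKernel_mul_rpow hN ha0 haN ht x 0
    rw [← DeformedHeat.eval_momentPoly_eq_laguerreSum (mul_pos ha0 ht).ne',
      DeformedHeat.momentPoly_zero hl] at h
    simpa only [Nat.cast_zero, zero_mul, Real.rpow_zero, one_mul, map_one, Complex.ofReal_one]
      using h
  · rw [DeformedHeat.eval_momentPoly_eq_laguerreSum (mul_pos ha0 ht).ne']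
    exact DeformedHeat.integral_heatKernel_mul_rpow hN ha0 haN ht x m
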